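/- Let $M$ be a smooth 3-manifold (possibly with boundary and corners) with a smooth Riemannian metric $g$, let $f>0$ be a smooth function on $M$, let $\lambda\in[0,1]$, and put $g'=f^4g$, $g_\lambda=f^{4\lambda}g$. For a metric written in coordinates as $(g_{ij})$ put $\mu_g=\sum_{i,j}(\partial_i g_{ij}-\partial_j g_{ii})\,dx^j$. (a) Let $M_{end}\subset M$ be open with a diffeomorphism $x:M_{end}\to\mathbb{R}^3\setminus \overline{B}_1$ in which $|\partial^l(g_{ij}-\delta_{ij})|=O(|x|^{-q-l})$ for $l=0,1,2$ and some $q\in(\tfrac12,1)$, and assume that the scalar curvature $R_g$ is integrable on $(M_{end},g)$. Suppose that, with $r=|x|$, $|f-1|+r|\nabla^g f|_g=O(r^{-q'})$ as $r\to\infty$ for some $q'\in(\tfrac12,1)$, and that $\Delta_g f$ is integrable on $(M_{end},g)$. Then the ADM masses in these coordinates, $$m(h)=\lim_{\rho\to\infty}\frac1{16\pi}\int_{S_\rho}\mu_h[n^0]\,d\sigma^0_\rho ,$$ where $S_\rho=\{|x|=\rho\}$ and $n^0$, $d\sigma^0_\rho$ are its Euclidean outer unit normal and area element, exist (as real numbers)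 for $h=g,g',g_\lambda$, and $$m(g_\lambda)=(1-\lambda)\,m(g)+\lambda\, m(g').$$ (b) Let $M_{end}\subset M$ be open with a diffeomorphism $y:M_{end}\to\{y_3\ge0,\ |y|>1\}\subset\mathbb{R}^3$ with respect to which both $g$ and $g'$ are asymptotically flat half-space metrics; that is, for $h=g$ and for $h=g'$, $|\partial^l(h_{ij}-\delta_{ij})|=O(|y|^{-q-l})$ for $l=0,1,2$ and some $q\in(\tfrac12,1)$ (depending on $h$), the scalar curvature of $h$ is integrable on $(M_{end},h)$, and the mean curvature of $\Sigma=\{y_3=0\}$ with respect to $h$ is integrable on $\Sigma$ for the area induced by $h$. Then the half-space masses $$m_\Sigma(h)=\lim_{\rho\to\infty}\frac1{16\pi}\Big(\int_{S^+_\rho}\mu_h[\mu^0]\,d\sigma^0_\rho+\int_{\partial S^+_\rho}\langle\partial_{y_3},\theta^0\rangle_h\,ds^0_\rho\Big),$$ where $S^+_\rho=\{|y|=\rho,\ y_3\ge0\}$, $\mu^0$ is its Euclidean outer unit normal, $\theta^0$ is the Euclidean outer unit conormal of the circle $\partial S^+_\rho$ in $\Sigma$, and $d\sigma^0_\rho$,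 $ds^0_\rho$ are the Euclidean area and length elements, exist (as real numbers) for $h=g,g',g_\lambda$, and $$m_\Sigma(g_\lambda)=(1-\lambda)\,m_\Sigma(g)+\lambda\, m_\Sigma(g').$$ -/

import Mathlib

open Bundle Filter MeasureTheory Asymptotics
open scoped Manifold ContDiff Topology

noncomputable section

namespace ConformalMass

/-- Euclidean three-space. -/
abbrev E3 : Type := EuclideanSpace ℝ (Fin 3)

/-- The Euclidean plane. -/
abbrev E2 : Type := EuclideanSpace ℝ (Fin 2)

/-- The complement of the closed unit ball in `ℝ³`. -/
def exterior : Set E3 := {x | 1 < ‖x‖}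

/-- The complement of the closed unit half-ball in the closed half-space `x₃ ≥ 0` of `ℝ³`
(the third coordinate has index `2`). -/
def halfExterior : Set E3 := {x | 0 ≤ x 2 ∧ 1 < ‖x‖}

/-- The point `(z₁, z₂, 0)` of the plane `x₃ = 0`. -/
def inPlane (z : E2) : E3 := !₂[z 0, z 1, 0]

section Coordinates

/-! ### Tensor calculus in a coordinate region

`U ⊆ ℝ³` is the coordinate region and `G x` is the matrix `(g_ij(x))` of a metric at `x ∈ U`.
Derivatives are taken within `U`, so that they are one-sided at boundary points of `U`. -/

variable (U : Set E3)

/-- The partial derivative `∂_i h` on `U`. -/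
def pd (i : Fin 3) (h : E3 → ℝ) (x : E3) : ℝ :=
  fderivWithin ℝ h U x (EuclideanSpace.single i 1)

/-- The filter of neighbourhoods of infinity in `U`. -/
def atInfinity : Filter E3 := Bornology.cobounded E3 ⊓ 𝓟 U

/-- `|∂^l (g_ij - δ_ij)| = O(|x|^(-q-l))` for `l = 0, 1, 2` and some `1/2 < q < 1`. -/
def DecaysToEuclidean (G : E3 → Matrix (Fin 3) (Fin 3) ℝ) : Prop :=
  ∃ q : ℝ, 1 / 2 < q ∧ q < 1 ∧ ∀ i j : Fin 3,
    ((fun x => G x i j - (1 : Matrix (Fin 3) (Fin 3) ℝ) i j)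
      =O[atInfinity U] fun x => ‖x‖ ^ (-q)) ∧
    (∀ k, pd U k (fun x => G x i j) =O[atInfinity U] fun x => ‖x‖ ^ (-q - 1)) ∧
    (∀ k l, pd U l (pd U k (fun x => G x i j)) =O[atInfinity U] fun x => ‖x‖ ^ (-q - 2))

/-- Christoffel symbols `Γ^k_ij = ½ ∑_l g^kl (∂_i g_jl + ∂_j g_il - ∂_l g_ij)`. -/
def christoffel (G : E3 → Matrix (Fin 3) (Fin 3) ℝ) (k i j : Fin 3) (x : E3) : ℝ :=
  1 / 2 * ∑ l, (G x)⁻¹ k l *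
    (pd U i (fun y => G y j l) x + pd U j (fun y => G y i l) x - pd U l (fun y => G y i j) x)

/-- Ricci curvature
`R_ij = ∑_k (∂_k Γ^k_ij - ∂_j Γ^k_ik) + ∑_{k,l} (Γ^k_kl Γ^l_ij - Γ^k_jl Γ^l_ik)`. -/
def ricci (G : E3 → Matrix (Fin 3) (Fin 3) ℝ) (i j : Fin 3) (x : E3) : ℝ :=
  ∑ k, (pd U k (christoffel U G k i j) x - pd U j (christoffel U G k i k) x)
    + ∑ k, ∑ l, (christoffel U G k k l x * christoffel U G l i j x
        - christoffel U G k j l x * christoffel U G l i k x)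

/-- Scalar curvature `∑_{i,j} g^ij R_ij`. -/
def scalarCurvature (G : E3 → Matrix (Fin 3) (Fin 3) ℝ) (x : E3) : ℝ :=
  ∑ i, ∑ j, (G x)⁻¹ i j * ricci U G i j x

/-- The density `√det(g_ij)` of the Riemannian volume with respect to Lebesgue measure. -/
def volumeDensity (G : E3 → Matrix (Fin 3) (Fin 3) ℝ) (x : E3) : ℝ := √(G x).det

/-- `h` is integrable on `U` for the Riemannian volume of `g`. -/
def IntegrableForVolume (G : E3 → Matrix (Fin 3) (Fin 3) ℝ) (h : E3 → ℝ) : Prop :=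
  IntegrableOn (fun x => h x * volumeDensity G x) U volume

/-- `|∇^g h|_g = (∑_{i,j} g^ij ∂_i h ∂_j h)^(1/2)`. -/
def gradientNorm (G : E3 → Matrix (Fin 3) (Fin 3) ℝ) (h : E3 → ℝ) (x : E3) : ℝ :=
  √(∑ i, ∑ j, (G x)⁻¹ i j * pd U i h x * pd U j h x)

/-- The Laplace-Beltrami operator
`Δ_g h = (det g)^(-1/2) ∑_{i,j} ∂_i ((det g)^(1/2) g^ij ∂_j h)`. -/
def laplacian (G : E3 → Matrix (Fin 3) (Fin 3) ℝ) (h : E3 → ℝ) (x : E3) : ℝ :=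
  (volumeDensity G x)⁻¹ *
    ∑ i, pd U i (fun y => ∑ j, volumeDensity G y * (G y)⁻¹ i j * pd U j h y) x

/-- The metric induced on the plane `x₃ = 0`. -/
def inducedMetric (G : E3 → Matrix (Fin 3) (Fin 3) ℝ) (z : E2) : Matrix (Fin 2) (Fin 2) ℝ :=
  (G (inPlane z)).submatrix Fin.castSucc Fin.castSucc

/-- Mean curvature of the boundary `x₃ = 0` of the region `x₃ ≥ 0`, at the point `(z, 0)`: the
trace, for the induced metric, of the second fundamental form `A(X, Y) = g(∇_X n, Y)` of the
outward unit normal `n`. As the one-form dual to `n` is `-(g^33)^(-1/2) dx₃`, the components of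
`A` are `-g(n, ∇_α ∂_β) = (g^33)^(-1/2) Γ^3_αβ`. -/
def meanCurvature (G : E3 → Matrix (Fin 3) (Fin 3) ℝ) (z : E2) : ℝ :=
  ∑ α : Fin 2, ∑ β : Fin 2, (inducedMetric G z)⁻¹ α β *
    (christoffel U G 2 α.castSucc β.castSucc (inPlane z) / √((G (inPlane z))⁻¹ 2 2))

/-- `h` is integrable on the part `|z| > 1` of the plane `x₃ = 0` for the Riemannian area. -/
def IntegrableForArea (G : E3 → Matrix (Fin 3) (Fin 3) ℝ) (h : E2 → ℝ) : Prop :=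
  IntegrableOn (fun z => h z * √(inducedMetric G z).det) {z : E2 | 1 < ‖z‖} volume

/-- The components `∑_i (∂_i g_ij - ∂_j g_ii)` of the mass one-form `μ_g`. -/
def massForm (G : E3 → Matrix (Fin 3) (Fin 3) ℝ) (j : Fin 3) (x : E3) : ℝ :=
  ∑ i, (pd U i (fun y => G y i j) x - pd U j (fun y => G y i i) x)

/-- The integral of `μ_g[n⁰]` over `S_ρ ∩ U` for the Euclidean area, where `S_ρ` is the
coordinate sphere of radius `ρ` and `n⁰ = x / ρ`; the integral is written as `ρ²` times an
integral over the unit sphere. For `ρ > 1`, the set `S_ρ ∩ U` is the full sphere if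
`U = exterior` and the upper hemisphere if `U = halfExterior`. -/
def massFlux (G : E3 → Matrix (Fin 3) (Fin 3) ℝ) (ρ : ℝ) : ℝ :=
  ρ ^ 2 * ∫ v in {v : Metric.sphere (0 : E3) 1 | ρ • (v : E3) ∈ U},
    (∑ j, massForm U G j (ρ • (v : E3)) * (v : E3) j) ∂(volume : Measure E3).toSphere

/-- The integral of `⟨∂_{x₃}, θ⁰⟩_g` over the circle of radius `ρ` in the plane `x₃ = 0` for
the Euclidean length, where `θ⁰ = (z, 0) / ρ` is the outer unit conormal; it is written as `ρ`
times an integral over the unit circle. -/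
def circleTerm (G : E3 → Matrix (Fin 3) (Fin 3) ℝ) (ρ : ℝ) : ℝ :=
  ρ * ∫ v : Metric.sphere (0 : E2) 1,
    (∑ j, G (inPlane (ρ • (v : E2))) 2 j * inPlane (v : E2) j) ∂(volume : Measure E2).toSphere

end Coordinates

section Manifold

variable {H : Type*} [TopologicalSpace H] (I : ModelWithCorners ℝ E3 H)
  (M : Type*) [TopologicalSpace M] [ChartedSpace H M]

/-- An end of `M` with coordinate region `U`: an open subset of `M` (the end) together with a
diffeomorphism onto `U ⊆ ℝ³`. -/
structure EndChart (U : Set E3) where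
  /-- the end, as a subset of `M` -/
  source : Set M
  isOpen_source : IsOpen source
  /-- the coordinates on the end -/
  toFun : M → E3
  /-- the inverse of the coordinate map -/
  invFun : E3 → M
  mapsTo : Set.MapsTo toFun source U
  mapsTo_inv : Set.MapsTo invFun U source
  left_inv : Set.LeftInvOn invFun toFun source
  right_inv : Set.RightInvOn invFun toFun U
  contMDiffOn : ContMDiffOn I 𝓘(ℝ, E3) ∞ toFun source
  contMDiffOn_inv : ContMDiffOn 𝓘(ℝ, E3) I ∞ invFun U

/-- Smooth Riemannian metrics on `M`. -/
abbrev Metric3 [IsManifold I ∞ M] : Type _ :=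
  ContMDiffRiemannianMetric I ∞ E3 (fun p : M => TangentSpace I p)

variable {I M} [IsManifold I ∞ M]

/-- The conformal metric `f^s g`, for a positive smooth function `f` and a real exponent `s`. -/
def conformal (g : Metric3 I M) (f : M → ℝ) (hf : ContMDiff I 𝓘(ℝ, ℝ) ∞ f)
    (hpos : ∀ p, 0 < f p) (s : ℝ) : Metric3 I M where
  inner p := f p ^ s • g.inner p
  symm p v w := by
    simp only [_root_.smul_apply]
    rw [g.symm]
  pos p v hv := by
    simp only [_root_.smul_apply, smul_eq_mul]
    exact mul_pos (Real.rpow_pos_of_pos (hpos p) s) (g.pos p v hv)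
  isVonNBounded p := by
    have hc : 0 < f p ^ s := Real.rpow_pos_of_pos (hpos p) s
    have hr : 0 < √(f p ^ s) := Real.sqrt_pos.2 hc
    have hb := (g.isVonNBounded p).image
      ((√(f p ^ s))⁻¹ • ContinuousLinearMap.id ℝ (TangentSpace I p))
    refine hb.subset ?_
    intro v hv
    refine ⟨√(f p ^ s) • v, ?_, ?_⟩
    · simp only [Set.mem_ofPred_eq, _root_.smul_apply, smul_eq_mul, map_smul] at hv ⊢
      rw [← mul_assoc, Real.mul_self_sqrt hc.le]
      exact hv
    · simp [smul_smul, mul_inv_cancel₀ hr.ne']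
  contMDiff := by
    have h1 : ContMDiff I 𝓘(ℝ, ℝ) ∞ (fun p => f p ^ s) := by
      intro p
      have h2 : ContDiffAt ℝ ∞ (fun t : ℝ => t ^ s) (f p) :=
        Real.contDiffAt_rpow_const_of_ne (hpos p).ne'
      exact h2.contMDiffAt.comp p (hf p)
    exact ContMDiff.smul_section (F := E3 →L[ℝ] E3 →L[ℝ] ℝ)
      (V := fun p : M => TangentSpace I p →L[ℝ] TangentSpace I p →L[ℝ] ℝ)
      (f := fun p => f p ^ s) (s := g.inner) h1 g.contMDiff

/-- The matrix `(g_ij(x))` of a metric in the coordinates of an end. -/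
def coordMetric {U : Set E3} (e : EndChart I M U) (g : Metric3 I M) (x : E3) :
    Matrix (Fin 3) (Fin 3) ℝ :=
  Matrix.of fun i j => g.inner (e.invFun x)
    (mfderivWithin 𝓘(ℝ, E3) I e.invFun U x (EuclideanSpace.single i (1 : ℝ)))
    (mfderivWithin 𝓘(ℝ, E3) I e.invFun U x (EuclideanSpace.single j (1 : ℝ)))

/-- `g` is asymptotically flat, with integrable scalar curvature, in the end `e`. -/
def IsAsymptoticallyFlat (e : EndChart I M exterior) (g : Metric3 I M) : Prop :=
  DecaysToEuclidean exterior (coordMetric e g) ∧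
  IntegrableForVolume exterior (coordMetric e g) (scalarCurvature exterior (coordMetric e g))

/-- The asymptotic conditions on the conformal factor: `|f - 1| + r |∇^g f|_g = O(r^(-q))` for
some `1/2 < q < 1`, and `Δ_g f` is integrable. -/
def IsConformalFactor (e : EndChart I M exterior) (g : Metric3 I M) (f : M → ℝ) : Prop :=
  (∃ q : ℝ, 1 / 2 < q ∧ q < 1 ∧
    (fun x => |f (e.invFun x) - 1|
        + ‖x‖ * gradientNorm exterior (coordMetric e g) (f ∘ e.invFun) x)
      =O[atInfinity exterior] fun x => ‖x‖ ^ (-q)) ∧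
  IntegrableForVolume exterior (coordMetric e g)
    (laplacian exterior (coordMetric e g) (f ∘ e.invFun))

/-- `g` is an asymptotically flat half-space metric in the end `e`: the metric decays to the
Euclidean one and the scalar curvature and the mean curvature of the boundary are integrable. -/
def IsAsymptoticallyFlatHalfSpace (e : EndChart I M halfExterior) (g : Metric3 I M) : Prop :=
  DecaysToEuclidean halfExterior (coordMetric e g) ∧
  IntegrableForVolume halfExterior (coordMetric e g)
    (scalarCurvature halfExterior (coordMetric e g)) ∧
  IntegrableForArea (coordMetric e g) (meanCurvature halfExterior (coordMetric e g))

/-- The ADM mass of `g` in the end `e` exists and equals `m`. -/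
def HasADMMass (e : EndChart I M exterior) (g : Metric3 I M) (m : ℝ) : Prop :=
  Tendsto (fun ρ : ℝ => 1 / (16 * Real.pi) * massFlux exterior (coordMetric e g) ρ)
    atTop (𝓝 m)

/-- The half-space mass `m_Σ` of `g` in the end `e` exists and equals `m`. -/
def HasHalfSpaceMass (e : EndChart I M halfExterior) (g : Metric3 I M) (m : ℝ) : Prop :=
  Tendsto (fun ρ : ℝ => 1 / (16 * Real.pi) *
      (massFlux halfExterior (coordMetric e g) ρ + circleTerm (coordMetric e g) ρ))
    atTop (𝓝 m)

end Manifold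

end ConformalMass

end

/-!
The Euclidean divergence of the mass one-form of an asymptotically flat metric agrees with the
density of its scalar curvature up to `O(r^(-2q-2))`, which is integrable because `q > 1/2`, so the
divergence theorem, applied to radial cut-offs of the one-form, shows that the flux through `S_ρ`
converges. On a half-space the boundary plane contributes twice the mean curvature minus the
divergence of the tangential field `(g₃₁, g₃₂)`, up to an error of the same kind, and the flux of
that field through circles is the circle term.

Multiplying the metric by `F^s` changes the mass one-form by `-2s dF + O(r^(-2q-1))`, and the
entries `g₃₁`, `g₃₂ = O(r^(-q))` of the circle term by `O(r^(-2q))`; both errors have flux tending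
to `0`. So the mass of `F^s g` is `m - s n`, an affine function of `s`, as soon as the flux of
`2 dF` has a limit `n`. On a full end the limit exists because `Δ_g F` is integrable; on a
half-space end it comes from the difference of the masses of `g` and `F⁴ g`, and `F` decays because
`F⁴` is a quotient of diagonal entries of the two metrics.
-/

namespace ConformalMass

/-! ### Limits from weak bounds on the derivative -/

section WeakBound

/-- A smooth step from `0` to `1` on the interval `[c, c + ε]`; its derivative approximates the
Dirac mass at `c`. -/
noncomputable def smoothStep (c ε r : ℝ) : ℝ := Real.smoothTransition ((r - c) / ε)

variable {c d ε r : ℝ}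

theorem contDiff_smoothStep (c ε : ℝ) : ContDiff ℝ 1 (smoothStep c ε) := by
  unfold smoothStep
  exact (Real.smoothTransition.contDiff (n := 1)).comp (by fun_prop)

theorem continuous_deriv_smoothStep (c ε : ℝ) : Continuous (deriv (smoothStep c ε)) :=
  (contDiff_smoothStep c ε).continuous_deriv le_rfl

theorem smoothStep_mem_Icc (c ε r : ℝ) : smoothStep c ε r ∈ Set.Icc (0 : ℝ) 1 :=
  ⟨Real.smoothTransition.nonneg _, Real.smoothTransition.le_one _⟩

theorem smoothStep_mono (hε : 0 < ε) : Monotone (smoothStep c ε) := fun _ _ h =>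
  Real.smoothTransition.monotone (by gcongr)

theorem smoothStep_anti_left (hε : 0 < ε) (h : c ≤ d) : smoothStep d ε r ≤ smoothStep c ε r :=
  Real.smoothTransition.monotone (by gcongr)

theorem smoothStep_of_le (hε : 0 < ε) (h : r ≤ c) : smoothStep c ε r = 0 :=
  Real.smoothTransition.zero_of_nonpos (div_nonpos_of_nonpos_of_nonneg (by linarith) hε.le)

theorem smoothStep_of_ge (hε : 0 < ε) (h : c + ε ≤ r) : smoothStep c ε r = 1 :=
  Real.smoothTransition.one_of_one_le (by rw [le_div_iff₀ hε]; linarith)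

theorem deriv_smoothStep_eq_zero (hε : 0 < ε) (h : r ∉ Set.Icc c (c + ε)) :
    deriv (smoothStep c ε) r = 0 := by
  rw [Set.mem_Icc, not_and_or, not_le, not_le] at h
  rcases h with h | h
  · have : smoothStep c ε =ᶠ[𝓝 r] fun _ => 0 := by
      filter_upwards [gt_mem_nhds h] with s hs using smoothStep_of_le hε hs.le
    rw [this.deriv_eq, deriv_const]
  · have : smoothStep c ε =ᶠ[𝓝 r] fun _ => 1 := by
      filter_upwards [lt_mem_nhds h] with s hs using smoothStep_of_ge hε hs.le
    rw [this.deriv_eq, deriv_const]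

theorem setIntegral_deriv_smoothStep (hε : 0 < ε) (h : c + ε ≤ d) :
    ∫ r in Set.Icc c d, deriv (smoothStep c ε) r = 1 := by
  rw [integral_Icc_eq_integral_Ioc, ← intervalIntegral.integral_of_le (by linarith),
    intervalIntegral.integral_deriv_eq_sub
      (fun x _ => (contDiff_smoothStep c ε).differentiable one_ne_zero x)
      ((continuous_deriv_smoothStep c ε).intervalIntegrable _ _),
    smoothStep_of_ge hε h, smoothStep_of_le hε le_rfl, sub_zero]

theorem tsupport_smoothStep_sub_subset (hε : 0 < ε) (h : c ≤ d) :
    tsupport (smoothStep c ε - smoothStep d ε) ⊆ Set.Icc c (d + ε) := by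
  refine closure_minimal (fun r hr => ?_) isClosed_Icc
  contrapose! hr
  rw [Set.mem_Icc, not_and_or, not_le, not_le] at hr
  rw [Function.mem_support, not_not, Pi.sub_apply]
  rcases hr with hr | hr
  · rw [smoothStep_of_le hε hr.le, smoothStep_of_le hε (by linarith), sub_self]
  · rw [smoothStep_of_ge hε (by linarith), smoothStep_of_ge hε hr.le, sub_self]

theorem smoothStep_sub_mem_Icc (hε : 0 < ε) (h : c ≤ d) :
    smoothStep c ε r - smoothStep d ε r ∈ Set.Icc (0 : ℝ) 1 := by
  have hd := (smoothStep_mem_Icc d ε r).1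
  have hc := (smoothStep_mem_Icc c ε r).2
  exact ⟨sub_nonneg.2 (smoothStep_anti_left hε h), by linarith⟩

variable {F : Type*} [NormedAddCommGroup F] [NormedSpace ℝ F] {Ψ : ℝ → F} {T : ℝ → ℝ} {R : ℝ}

theorem integrable_deriv_smoothStep_smul (hε : 0 < ε) (hΨ : ContinuousOn Ψ (Set.Icc c (c + ε))) :
    Integrable fun r => deriv (smoothStep c ε) r • Ψ r := by
  rw [← integrableOn_iff_integrable_of_support_subset (s := Set.Icc c (c + ε))]
  · exact ((continuous_deriv_smoothStep c ε).continuousOn.smul hΨ).integrableOn_compact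
      isCompact_Icc
  · intro r hr
    contrapose! hr
    rw [Function.mem_support, not_not, deriv_smoothStep_eq_zero hε hr, zero_smul]

theorem tendsto_integral_deriv_smoothStep_smul [CompleteSpace F] (hc : R < c)
    (hΨ : ContinuousOn Ψ (Set.Ioi R)) :
    Tendsto (fun ε => ∫ r, deriv (smoothStep c ε) r • Ψ r) (𝓝[>] 0) (𝓝 (Ψ c)) := by
  set s := Set.Icc c (c + 1)
  have hΨs : ContinuousOn Ψ s := hΨ.mono fun r hr => hc.trans_le hr.1
  have hsmall : ∀ᶠ ε in 𝓝[>] (0 : ℝ), 0 < ε ∧ ε < 1 :=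
    Ioo_mem_nhdsGT one_pos
  have hpeak : Tendsto (fun ε => ∫ r in s, deriv (smoothStep c ε) r • Ψ r) (𝓝[>] 0)
      (𝓝 (Ψ c)) := by
    refine tendsto_setIntegral_peak_smul_of_integrableOn_of_tendsto measurableSet_Icc
      measurableSet_Icc subset_rfl self_mem_nhdsWithin isCompact_Icc.measure_lt_top.ne
      ?nonneg ?uniform ?mass ?measurable (hΨs.integrableOn_compact isCompact_Icc)
      (hΨs c ⟨le_rfl, by linarith⟩)
    case nonneg =>
      filter_upwards [hsmall] with ε hε r _ using (smoothStep_mono hε.1).deriv_nonneg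
    case mass =>
      refine tendsto_const_nhds.congr' ?_
      filter_upwards [hsmall] with ε hε
      rw [setIntegral_deriv_smoothStep hε.1 (by linarith)]
    case measurable =>
      exact Eventually.of_forall fun ε =>
        (continuous_deriv_smoothStep c ε).aestronglyMeasurable
    case uniform =>
      intro u hu hcu
      obtain ⟨δ, hδ, hball⟩ := Metric.isOpen_iff.1 hu c hcu
      rw [Metric.tendstoUniformlyOn_iff]
      intro η hη
      filter_upwards [Ioo_mem_nhdsGT hδ] with ε hε r hr
      have hrε : r ∉ Set.Icc c (c + ε) := fun h => hr.2 <| hball <| by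
        rw [Metric.mem_ball, Real.dist_eq, abs_of_nonneg (by linarith [h.1])]
        linarith [h.2, hε.2]
      rwa [deriv_smoothStep_eq_zero hε.1 hrε, Pi.zero_apply, dist_self]
  refine hpeak.congr' ?_
  filter_upwards [hsmall] with ε hε
  refine setIntegral_eq_integral_of_forall_compl_eq_zero fun r hr => ?_
  rw [deriv_smoothStep_eq_zero hε.1 fun h => hr ⟨h.1, by linarith [h.2, hε.2]⟩, zero_smul]

theorem norm_sub_le_of_weak_bound [CompleteSpace F] (hΨ : ContinuousOn Ψ (Set.Ioi R))
    (h : ∀ a, R < a → ∀ φ : ℝ → ℝ, ContDiff ℝ 1 φ → HasCompactSupport φ →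
      tsupport φ ⊆ Set.Ici a → (∀ r, φ r ∈ Set.Icc (0 : ℝ) 1) → ‖∫ r, deriv φ r • Ψ r‖ ≤ T a)
    (hc : R < c) (hcd : c ≤ d) : ‖Ψ c - Ψ d‖ ≤ T c := by
  have hlim := (tendsto_integral_deriv_smoothStep_smul hc hΨ).sub
    (tendsto_integral_deriv_smoothStep_smul (hc.trans_le hcd) hΨ)
  refine le_of_tendsto hlim.norm ?_
  filter_upwards [self_mem_nhdsWithin] with ε (hε : 0 < ε)
  have hsupp := tsupport_smoothStep_sub_subset hε hcd
  have hΨ' : ∀ {b}, R < b → ContinuousOn Ψ (Set.Icc b (b + ε)) := fun hb =>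
    hΨ.mono fun r hr => hb.trans_le hr.1
  have hderiv : ∀ r, deriv (smoothStep c ε - smoothStep d ε) r • Ψ r
      = deriv (smoothStep c ε) r • Ψ r - deriv (smoothStep d ε) r • Ψ r := fun r => by
    rw [deriv_sub ((contDiff_smoothStep c ε).differentiable one_ne_zero r)
      ((contDiff_smoothStep d ε).differentiable one_ne_zero r), sub_smul]
  have hbound := h c hc (smoothStep c ε - smoothStep d ε)
    ((contDiff_smoothStep c ε).sub (contDiff_smoothStep d ε))
    (isCompact_Icc.of_isClosed_subset (isClosed_tsupport _) hsupp)
    (hsupp.trans Set.Icc_subset_Ici_self) fun r => smoothStep_sub_mem_Icc hε hcd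
  simp_rw [hderiv] at hbound
  rwa [integral_sub (integrable_deriv_smoothStep_smul hε (hΨ' hc))
    (integrable_deriv_smoothStep_smul hε (hΨ' (hc.trans_le hcd)))] at hbound

theorem exists_tendsto_of_weak_bound [CompleteSpace F] (hΨ : ContinuousOn Ψ (Set.Ioi R))
    (hT : Tendsto T atTop (𝓝 0))
    (h : ∀ a, R < a → ∀ φ : ℝ → ℝ, ContDiff ℝ 1 φ → HasCompactSupport φ →
      tsupport φ ⊆ Set.Ici a → (∀ r, φ r ∈ Set.Icc (0 : ℝ) 1) → ‖∫ r, deriv φ r • Ψ r‖ ≤ T a) :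
    ∃ L, Tendsto Ψ atTop (𝓝 L) := by
  have hmax : Tendsto (fun x : ℝ => max x (R + 1)) atTop atTop :=
    tendsto_atTop_mono (fun x => le_max_left _ _) tendsto_id
  have hcauchy : CauchySeq fun x : ℝ => Ψ (max x (R + 1)) := by
    refine cauchySeq_of_le_tendsto_0' (fun x => T (max x (R + 1))) (fun x y hxy => ?_)
      (hT.comp hmax)
    rw [dist_eq_norm]
    exact norm_sub_le_of_weak_bound hΨ h (lt_max_of_lt_right (by linarith))
      (max_le_max hxy le_rfl)
  obtain ⟨L, hL⟩ := cauchySeq_tendsto_of_complete hcauchy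
  refine ⟨L, hL.congr' ?_⟩
  filter_upwards [eventually_ge_atTop (R + 1)] with x hx
  rw [max_eq_left hx]

end WeakBound

/-! ### Polar coordinates on cones -/

section Polar

variable {E F : Type*} [NormedAddCommGroup E] [NormedSpace ℝ E] [FiniteDimensional ℝ E]
  [MeasurableSpace E] [BorelSpace E] [Nontrivial E] [NormedAddCommGroup F] [NormedSpace ℝ F]
  (μ : Measure E) [μ.IsAddHaarMeasure]

theorem integral_eq_integral_toSphere {h : E → F} (hh : Integrable h μ) :
    ∫ x, h x ∂μ = ∫ r in Set.Ioi (0 : ℝ), r ^ (Module.finrank ℝ E - 1) •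
      ∫ v : Metric.sphere (0 : E) 1, h (r • (v : E)) ∂μ.toSphere := by
  have hmp := μ.measurePreserving_homeomorphUnitSphereProd
  have hme := (homeomorphUnitSphereProd E).measurableEmbedding
  have hcongr : (fun x : ({0}ᶜ : Set E) => h x) = (fun p : Metric.sphere (0 : E) 1 ×
      Set.Ioi (0 : ℝ) => h ((p.2 : ℝ) • (p.1 : E))) ∘ homeomorphUnitSphereProd E := by
    ext x
    rw [Function.comp_apply, ← homeomorphUnitSphereProd_symm_apply_coe,
      Homeomorph.symm_apply_apply]
  have hint : Integrable (fun p : Metric.sphere (0 : E) 1 × Set.Ioi (0 : ℝ) =>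
      h ((p.2 : ℝ) • (p.1 : E))) (μ.toSphere.prod (.volumeIoiPow (Module.finrank ℝ E - 1))) := by
    rw [← hmp.integrable_comp_emb hme, ← hcongr]
    have := hh.integrableOn (s := ({0}ᶜ : Set E))
    rwa [integrableOn_iff_comap_subtypeVal (measurableSet_singleton _).compl] at this
  calc ∫ x, h x ∂μ = ∫ x : ({(0)}ᶜ : Set E), h x ∂(μ.comap (↑)) := by
        rw [integral_subtype_comap (measurableSet_singleton _).compl fun x ↦ h x,
          MeasureTheory.restrict_compl_singleton]
    _ = ∫ p, h ((p.2 : ℝ) • (p.1 : E)) ∂μ.toSphere.prod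
          (.volumeIoiPow (Module.finrank ℝ E - 1)) := by
        rw [← hmp.integral_comp hme]
        exact congrArg (fun F => ∫ x, F x ∂(μ.comap (↑))) hcongr
    _ = ∫ r : Set.Ioi (0 : ℝ), ∫ v : Metric.sphere (0 : E) 1, h ((r : ℝ) • (v : E)) ∂μ.toSphere
          ∂.volumeIoiPow (Module.finrank ℝ E - 1) := integral_prod_symm _ hint
    _ = _ := by
      simp only [Measure.volumeIoiPow, ENNReal.ofReal]
      rw [integral_withDensity_eq_integral_smul (by fun_prop),
        integral_subtype_comap measurableSet_Ioi fun a ↦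
          Real.toNNReal (a ^ (Module.finrank ℝ E - 1)) •
            ∫ v : Metric.sphere (0 : E) 1, h (a • (v : E)) ∂μ.toSphere]
      refine setIntegral_congr_fun measurableSet_Ioi fun r hr ↦ ?_
      rw [NNReal.smul_def, Real.coe_toNNReal _ (pow_nonneg hr.out.le _)]

end Polar

section Cone

theorem isOpen_one_lt_norm {E : Type*} [SeminormedAddCommGroup E] : IsOpen {x : E | 1 < ‖x‖} :=
  isOpen_lt continuous_const continuous_norm

variable {E : Type*} [NormedAddCommGroup E] [NormedSpace ℝ E] {C : Set E} {ρ : ℝ}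

/-- A closed cone on which derivatives are unique: the model at infinity of the coordinate region
of an end. -/
structure IsRegularCone (C : Set E) : Prop where
  isClosed : IsClosed C
  uniqueDiffOn : UniqueDiffOn ℝ C
  smul_mem_iff : ∀ ρ : ℝ, 0 < ρ → ∀ v, ρ • v ∈ C ↔ v ∈ C

theorem isRegularCone_univ : IsRegularCone (Set.univ : Set E) :=
  ⟨isClosed_univ, uniqueDiffOn_univ, by simp⟩

/-- The part of a set outside the closed unit ball, the coordinate region of an end modelled on a
cone. -/
def outer (C : Set E) : Set E := C ∩ {x | 1 < ‖x‖}

namespace IsRegularCone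

theorem uniqueDiffOn_outer (hC : IsRegularCone C) : UniqueDiffOn ℝ (outer C) :=
  hC.uniqueDiffOn.inter isOpen_one_lt_norm

theorem measurableSet_outer [MeasurableSpace E] [BorelSpace E] (hC : IsRegularCone C) :
    MeasurableSet (outer C) :=
  hC.isClosed.measurableSet.inter isOpen_one_lt_norm.measurableSet

theorem isClosed_sphere_inter (hC : IsRegularCone C) :
    IsClosed {v : Metric.sphere (0 : E) 1 | (v : E) ∈ C} :=
  hC.isClosed.preimage continuous_subtype_val

theorem setOf_smul_mem_outer (hC : IsRegularCone C) (hρ : 1 < ρ) :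
    {v : Metric.sphere (0 : E) 1 | ρ • (v : E) ∈ outer C}
      = {v : Metric.sphere (0 : E) 1 | (v : E) ∈ C} := by
  ext v
  have h0 : 0 < ρ := by linarith
  simp [outer, hC.smul_mem_iff ρ h0, norm_smul, abs_of_pos h0, hρ]

theorem smul_mem_outer (hC : IsRegularCone C) (hρ : 1 < ρ) {v : Metric.sphere (0 : E) 1}
    (hv : (v : E) ∈ C) : ρ • (v : E) ∈ outer C :=
  (hC.setOf_smul_mem_outer hρ).ge hv

theorem setIntegral_eq_integral_toSphere [FiniteDimensional ℝ E] [MeasurableSpace E]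
    [BorelSpace E] [Nontrivial E] {F : Type*} [NormedAddCommGroup F] [NormedSpace ℝ F]
    (μ : Measure E) [μ.IsAddHaarMeasure] (hC : IsRegularCone C) {h : E → F}
    (hh : IntegrableOn h C μ) :
    ∫ x in C, h x ∂μ = ∫ r in Set.Ioi (0 : ℝ), r ^ (Module.finrank ℝ E - 1) •
      ∫ v in {v : Metric.sphere (0 : E) 1 | (v : E) ∈ C}, h (r • (v : E)) ∂μ.toSphere := by
  rw [← integral_indicator hC.isClosed.measurableSet,
    integral_eq_integral_toSphere μ (hh.integrable_indicator hC.isClosed.measurableSet)]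
  refine setIntegral_congr_fun measurableSet_Ioi fun r (hr : 0 < r) => ?_
  rw [← integral_indicator hC.isClosed_sphere_inter.measurableSet]
  congr 2 with v
  exact Set.indicator_eq_indicator (hC.smul_mem_iff r hr v) rfl

end IsRegularCone

end Cone

/-! ### Radial cutoffs -/

section Cutoff

/-- A compactly supported `C^k` function on `(1, ∞)`; composed with the norm, it localizes
functions that are only defined outside the closed unit ball. -/
structure IsRadialCutoff (k : WithTop ℕ∞) (φ : ℝ → ℝ) : Prop where
  contDiff : ContDiff ℝ k φ
  hasCompactSupport : HasCompactSupport φ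
  tsupport_subset : tsupport φ ⊆ Set.Ioi 1

namespace IsRadialCutoff

variable {k : WithTop ℕ∞} {φ : ℝ → ℝ}

protected theorem deriv (hφ : IsRadialCutoff 1 φ) : IsRadialCutoff 0 (deriv φ) where
  contDiff := contDiff_zero.2 (hφ.contDiff.continuous_deriv le_rfl)
  hasCompactSupport := hφ.hasCompactSupport.deriv
  tsupport_subset := tsupport_deriv_subset.trans hφ.tsupport_subset

protected theorem continuous (hφ : IsRadialCutoff k φ) : Continuous φ := hφ.contDiff.continuous

theorem eq_zero_of_le_one (hφ : IsRadialCutoff k φ) {r : ℝ} (hr : r ≤ 1) : φ r = 0 :=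
  image_eq_zero_of_notMem_tsupport fun h => hr.not_gt (hφ.tsupport_subset h)

variable {E F : Type*} [NormedAddCommGroup E] [NormedAddCommGroup F] [NormedSpace ℝ F]
  {C : Set E} {X : E → F} {x : E}

theorem eventuallyEq_zero (hφ : IsRadialCutoff k φ) (hx : ‖x‖ ≤ 1) :
    (fun y => φ ‖y‖ • X y) =ᶠ[𝓝 x] fun _ => 0 := by
  have hmem : ‖x‖ ∈ (tsupport φ)ᶜ := fun h => hx.not_gt (hφ.tsupport_subset h)
  filter_upwards [continuous_norm.continuousAt.preimage_mem_nhds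
    ((isClosed_tsupport φ).isOpen_compl.mem_nhds hmem)] with y hy
  rw [image_eq_zero_of_notMem_tsupport hy, zero_smul]

theorem hasCompactSupport_smul [ProperSpace E] (hφ : IsRadialCutoff k φ) (X : E → F) :
    HasCompactSupport fun x => φ ‖x‖ • X x := by
  obtain ⟨b, hb⟩ := hφ.hasCompactSupport.isBounded.subset_closedBall (0 : ℝ)
  refine HasCompactSupport.intro (isCompact_closedBall (0 : E) b) fun x hx => ?_
  have hφx : ‖x‖ ∉ tsupport φ := fun h =>
    hx (by simpa only [mem_closedBall_zero_iff, norm_norm] using hb h)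
  rw [image_eq_zero_of_notMem_tsupport hφx, zero_smul]

theorem continuousOn_smul (hφ : IsRadialCutoff k φ) (hX : ContinuousOn X (outer C)) :
    ContinuousOn (fun x => φ ‖x‖ • X x) C := by
  intro x hx
  by_cases h : 1 < ‖x‖
  · have hXx : ContinuousWithinAt X C x :=
      (continuousWithinAt_inter (isOpen_one_lt_norm.mem_nhds h)).1
        (hX x ⟨hx, h⟩)
    exact (hφ.continuous.comp continuous_norm).continuousWithinAt.smul hXx
  · exact (continuousAt_const.congr
      (hφ.eventuallyEq_zero (not_lt.1 h)).symm).continuousWithinAt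

theorem integrableOn_smul [ProperSpace E] [MeasurableSpace E] [BorelSpace E] {μ : Measure E}
    [IsFiniteMeasureOnCompacts μ] (hφ : IsRadialCutoff k φ) (hC : IsClosed C)
    (hX : ContinuousOn X (outer C)) : IntegrableOn (fun x => φ ‖x‖ • X x) C μ := by
  have hK : IsCompact (C ∩ tsupport fun x => φ ‖x‖ • X x) :=
    (hφ.hasCompactSupport_smul X).isCompact.inter_left hC
  refine (((hφ.continuousOn_smul hX).mono Set.inter_subset_left).integrableOn_compact
    hK).of_forall_sdiff_eq_zero hC.measurableSet fun x hx => ?_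
  exact image_eq_zero_of_notMem_tsupport (f := fun x => φ ‖x‖ • X x) fun h => hx.2 ⟨hx.1, h⟩

end IsRadialCutoff

section InnerProductSpace

variable {E F : Type*} [NormedAddCommGroup E] [InnerProductSpace ℝ E] [NormedAddCommGroup F]
  [NormedSpace ℝ F] {C : Set E} {X : E → F} {x : E} {k : WithTop ℕ∞} {φ : ℝ → ℝ}

theorem IsRadialCutoff.contDiffOn_smul (hφ : IsRadialCutoff k φ)
    (hX : ContDiffOn ℝ k X (outer C)) : ContDiffOn ℝ k (fun x => φ ‖x‖ • X x) C := by
  intro x hx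
  by_cases h : 1 < ‖x‖
  · have hXx : ContDiffWithinAt ℝ k X C x :=
      (contDiffWithinAt_inter (isOpen_one_lt_norm.mem_nhds h)).1 (hX x ⟨hx, h⟩)
    have h0 : x ≠ 0 := norm_pos_iff.1 (one_pos.trans h)
    exact (hφ.contDiff.contDiffAt.comp x (contDiffAt_norm ℝ h0)).contDiffWithinAt.smul hXx
  · exact (contDiffAt_const.congr_of_eventuallyEq
      (hφ.eventuallyEq_zero (not_lt.1 h))).contDiffWithinAt

theorem hasFDerivAt_norm (hx : x ≠ 0) :
    HasFDerivAt (fun y : E => ‖y‖) (‖x‖⁻¹ • innerSL ℝ x) x := by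
  have hsq := (hasStrictFDerivAt_norm_sq x).hasFDerivAt.sqrt (by positivity)
  simp only [Real.sqrt_sq (norm_nonneg _)] at hsq
  refine hsq.congr_fderiv ?_
  ext v
  simp only [_root_.smul_apply, smul_eq_mul, nsmul_eq_mul, Nat.cast_ofNat, one_div, mul_inv]
  ring

theorem IsRadialCutoff.fderivWithin_smul (hφ : IsRadialCutoff 1 φ) (hC : IsRegularCone C)
    (hX : DifferentiableOn ℝ X (outer C)) (hx : x ∈ C) :
    fderivWithin ℝ (fun x => φ ‖x‖ • X x) C x = φ ‖x‖ • fderivWithin ℝ X (outer C) x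
      + ((deriv φ ‖x‖ * ‖x‖⁻¹) • innerSL ℝ x).smulRight (X x) := by
  by_cases h : 1 < ‖x‖
  · have hXx : HasFDerivWithinAt X (fderivWithin ℝ X (outer C) x) C x :=
      (hasFDerivWithinAt_inter (isOpen_one_lt_norm.mem_nhds h)).1
        (hX x ⟨hx, h⟩).hasFDerivWithinAt
    have hφx : HasDerivAt φ (deriv φ ‖x‖) ‖x‖ :=
      (hφ.contDiff.differentiable one_ne_zero _).hasDerivAt
    have hnorm := hasFDerivAt_norm (norm_pos_iff.1 (one_pos.trans h))
    have hφnorm := (hφx.comp_hasFDerivAt x hnorm).hasFDerivWithinAt (s := C)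
    rw [smul_smul] at hφnorm
    exact (hφnorm.smul hXx).fderivWithin (hC.uniqueDiffOn x hx)
  · have hz := hφ.eventuallyEq_zero (X := X) (not_lt.1 h)
    rw [(hz.filter_mono nhdsWithin_le_nhds).fderivWithin_eq hz.self_of_nhds,
      hφ.eq_zero_of_le_one (not_lt.1 h), hφ.deriv.eq_zero_of_le_one (not_lt.1 h)]
    simp

end InnerProductSpace

end Cutoff

/-! ### The weak form of the divergence theorem on a cone -/

section Divergence

open scoped InnerProductSpace

theorem continuousOn_setIntegral_of_isCompact {X Y F : Type*} [TopologicalSpace X]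
    [FirstCountableTopology X] [TopologicalSpace Y] [MeasurableSpace Y] [OpensMeasurableSpace Y]
    [SecondCountableTopology Y] {μ : Measure Y} [IsFiniteMeasureOnCompacts μ]
    [NormedAddCommGroup F] [NormedSpace ℝ F] {s : Set X} [LocallyCompactSpace s] {K : Set Y}
    (hK : IsCompact K) (hKm : MeasurableSet K) {f : X → Y → F}
    (hf : ContinuousOn f.uncurry (s ×ˢ K)) : ContinuousOn (fun x => ∫ y in K, f x y ∂μ) s := by
  have : CompactSpace K := isCompact_iff_compactSpace.1 hK
  have : IsFiniteMeasure (μ.comap (Subtype.val : K → Y)) := ⟨by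
    rw [comap_subtype_coe_apply hKm, Set.image_univ, Subtype.range_coe]
    exact hK.measure_lt_top⟩
  have hcont : Continuous (Function.uncurry fun (x : s) (y : K) => f x y) :=
    hf.comp_continuous (f := fun p : s × K => ((p.1 : X), (p.2 : Y))) (by fun_prop) fun p =>
      ⟨p.1.2, p.2.2⟩
  rw [continuousOn_iff_continuous_domRestrict]
  refine (continuous_parametric_integral_of_continuous (μ := μ.comap (Subtype.val : K → Y)) hcont
    isCompact_univ).congr fun x => ?_
  rw [setIntegral_univ, integral_subtype_comap hKm (f x), Set.domRestrict_apply]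

theorem integral_fderiv_eq_zero {E F : Type*} [NormedAddCommGroup E] [NormedSpace ℝ E]
    [FiniteDimensional ℝ E] [MeasurableSpace E] [BorelSpace E] (μ : Measure E)
    [μ.IsAddHaarMeasure] [NormedAddCommGroup F] [NormedSpace ℝ F] {X : E → F}
    (hX : ContDiff ℝ 1 X) (hs : HasCompactSupport X) : ∫ x, fderiv ℝ X x ∂μ = 0 := by
  have hint : Integrable (fderiv ℝ X) μ :=
    (hX.continuous_fderiv one_ne_zero).integrable_of_hasCompactSupport (hs.fderiv ℝ)
  ext v
  have hparts := integral_smul_fderiv_eq_neg_fderiv_smul_of_integrable (μ := μ) (𝕜 := ℝ)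
    (f := fun _ : E => (1 : ℝ)) (g := X) (v := v) (by simp)
    (by simpa only [one_smul] using hint.apply_continuousLinearMap v)
    (by simpa only [one_smul] using hX.continuous.integrable_of_hasCompactSupport hs)
    (fun x _ => differentiableAt_const _) (fun x _ => hX.differentiable one_ne_zero x)
  rw [ContinuousLinearMap.integral_apply hint]
  simpa using hparts

/-- The trace of an endomorphism of a finite-dimensional space, as a continuous linear map. -/
noncomputable def traceL (E : Type*) [NormedAddCommGroup E] [NormedSpace ℝ E]
    [FiniteDimensional ℝ E] : (E →L[ℝ] E) →L[ℝ] ℝ :=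
  (LinearMap.trace ℝ E ∘ₗ ContinuousLinearMap.coeLM ℝ).toContinuousLinearMap

section NormedSpace

variable {E : Type*} [NormedAddCommGroup E] [NormedSpace ℝ E] [FiniteDimensional ℝ E]
  {U : Set E} {X : E → E}

theorem traceL_smulRight (l : E →L[ℝ] ℝ) (v : E) : traceL E (l.smulRight v) = l v :=
  LinearMap.trace_smulRight (l : E →ₗ[ℝ] ℝ) v

/-- The divergence of a vector field on `U`, with derivatives taken within `U`. -/
noncomputable def divergence (U : Set E) (X : E → E) (x : E) : ℝ :=
  traceL E (fderivWithin ℝ X U x)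

theorem continuousOn_divergence (hU : UniqueDiffOn ℝ U) (hX : ContDiffOn ℝ 1 X U) :
    ContinuousOn (divergence U X) U :=
  (traceL E).continuous.comp_continuousOn (hX.continuousOn_fderivWithin hU le_rfl)

theorem integral_divergence_univ_eq_zero [MeasurableSpace E] [BorelSpace E] (μ : Measure E)
    [μ.IsAddHaarMeasure] (hX : ContDiff ℝ 1 X) (hs : HasCompactSupport X) :
    ∫ x, divergence Set.univ X x ∂μ = 0 := by
  have hint : Integrable (fderiv ℝ X) μ :=
    (hX.continuous_fderiv one_ne_zero).integrable_of_hasCompactSupport (hs.fderiv ℝ)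
  simp only [divergence, fderivWithin_univ]
  rw [(traceL E).integral_comp_comm hint, integral_fderiv_eq_zero μ hX hs, map_zero]

end NormedSpace

theorem continuousOn_radialComponent {E : Type*} [NormedAddCommGroup E] [InnerProductSpace ℝ E]
    {C : Set E} {X : E → E} (hX : ContinuousOn X (outer C)) :
    ContinuousOn (fun x => ‖x‖⁻¹ * ⟪x, X x⟫_ℝ) (outer C) :=
  (continuous_norm.continuousOn.inv₀ fun _ hx => (one_pos.trans hx.2).ne').mul
    (continuousOn_id.inner hX)

theorem IsRegularCone.continuousOn_inner_smul {E : Type*} [NormedAddCommGroup E]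
    [InnerProductSpace ℝ E] {C : Set E} {X : E → E} (hC : IsRegularCone C)
    (hX : ContinuousOn X (outer C)) :
    ContinuousOn (Function.uncurry fun (ρ : ℝ) (v : Metric.sphere (0 : E) 1) =>
      ⟪(v : E), X (ρ • (v : E))⟫_ℝ)
      (Set.Ioi (1 : ℝ) ×ˢ {v : Metric.sphere (0 : E) 1 | (v : E) ∈ C}) := by
  refine ContinuousOn.inner (by fun_prop) (hX.comp (by fun_prop) ?_)
  rintro ⟨ρ, v⟩ ⟨hρ, hv⟩
  exact hC.smul_mem_outer hρ hv

variable {E : Type*} [NormedAddCommGroup E] [InnerProductSpace ℝ E] [FiniteDimensional ℝ E]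
  {C : Set E} {X : E → E} {φ : ℝ → ℝ}

theorem IsRadialCutoff.divergence_smul (hφ : IsRadialCutoff 1 φ) (hC : IsRegularCone C)
    (hX : DifferentiableOn ℝ X (outer C)) {x : E} (hx : x ∈ C) :
    divergence C (fun x => φ ‖x‖ • X x) x
      = φ ‖x‖ * divergence (outer C) X x + deriv φ ‖x‖ * (‖x‖⁻¹ * ⟪x, X x⟫_ℝ) := by
  rw [divergence, hφ.fderivWithin_smul hC hX hx, map_add, map_smul, traceL_smulRight, divergence,
    smul_eq_mul, _root_.smul_apply, innerSL_apply_apply, smul_eq_mul, mul_assoc]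

variable [MeasurableSpace E] [BorelSpace E]

/-- The flux of a vector field through the part of the sphere of radius `ρ` in `U`, as an integral
over the unit sphere. -/
noncomputable def flux (U : Set E) (X : E → E) (ρ : ℝ) : ℝ :=
  ρ ^ (Module.finrank ℝ E - 1) * ∫ v in {v : Metric.sphere (0 : E) 1 | ρ • (v : E) ∈ U},
    ⟪(v : E), X (ρ • (v : E))⟫_ℝ ∂(volume : Measure E).toSphere

theorem IsRegularCone.flux_outer (hC : IsRegularCone C) (X : E → E) {ρ : ℝ} (hρ : 1 < ρ) :
    flux (outer C) X ρ = ρ ^ (Module.finrank ℝ E - 1) *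
      ∫ v in {v : Metric.sphere (0 : E) 1 | (v : E) ∈ C},
        ⟪(v : E), X (ρ • (v : E))⟫_ℝ ∂(volume : Measure E).toSphere := by
  rw [flux, hC.setOf_smul_mem_outer hρ]

theorem IsRegularCone.continuousOn_flux (hC : IsRegularCone C) (hX : ContinuousOn X (outer C)) :
    ContinuousOn (flux (outer C) X) (Set.Ioi 1) := by
  have : LocallyCompactSpace (Set.Ioi (1 : ℝ)) := isOpen_Ioi.locallyCompactSpace
  have hcont := continuousOn_setIntegral_of_isCompact (μ := (volume : Measure E).toSphere)
    hC.isClosed_sphere_inter.isCompact hC.isClosed_sphere_inter.measurableSet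
    (hC.continuousOn_inner_smul hX)
  exact (((continuous_id.pow _).continuousOn).mul hcont).congr fun ρ hρ => hC.flux_outer X hρ

theorem IsRegularCone.integral_radial_mul [Nontrivial E] (hC : IsRegularCone C)
    (hφ : IsRadialCutoff 0 φ) (hX : ContinuousOn X (outer C)) :
    ∫ x in C, φ ‖x‖ * (‖x‖⁻¹ * ⟪x, X x⟫_ℝ) = ∫ r, φ r * flux (outer C) X r := by
  have hzero : ∀ r ∉ Set.Ioi (0 : ℝ), φ r * flux (outer C) X r = 0 := fun r hr => by
    rw [hφ.eq_zero_of_le_one ((not_lt.1 hr).trans zero_le_one), zero_mul]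
  have hint := hφ.integrableOn_smul (μ := volume) hC.isClosed (continuousOn_radialComponent hX)
  simp only [smul_eq_mul] at hint
  rw [hC.setIntegral_eq_integral_toSphere volume hint,
    ← setIntegral_eq_integral_of_forall_compl_eq_zero hzero]
  refine setIntegral_congr_fun measurableSet_Ioi fun r (hr : 0 < r) => ?_
  have hpolar : ∀ v : Metric.sphere (0 : E) 1,
      φ ‖r • (v : E)‖ * (‖r • (v : E)‖⁻¹ * ⟪r • (v : E), X (r • (v : E))⟫_ℝ)
        = φ r * ⟪(v : E), X (r • (v : E))⟫_ℝ := fun v => by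
    rw [norm_smul, Real.norm_of_nonneg hr.le, norm_eq_of_mem_sphere, mul_one, real_inner_smul_left,
      inv_mul_cancel_left₀ hr.ne']
  simp only [hpolar, integral_const_mul, smul_eq_mul]
  rcases le_or_gt r 1 with hr1 | hr1
  · rw [hφ.eq_zero_of_le_one hr1, zero_mul, zero_mul, mul_zero]
  · rw [hC.flux_outer X hr1, mul_left_comm]

theorem IsRegularCone.integral_deriv_mul_flux [Nontrivial E] (hC : IsRegularCone C)
    (hφ : IsRadialCutoff 1 φ) (hX : ContDiffOn ℝ 1 X (outer C)) :
    ∫ r, deriv φ r * flux (outer C) X r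
      = (∫ x in C, divergence C (fun x => φ ‖x‖ • X x) x)
        - ∫ x in outer C, φ ‖x‖ * divergence (outer C) X x := by
  have hdiv := hφ.integrableOn_smul (μ := volume) hC.isClosed
    (continuousOn_divergence hC.uniqueDiffOn_outer hX)
  have hradial := hφ.deriv.integrableOn_smul (μ := volume) hC.isClosed
    (continuousOn_radialComponent hX.continuousOn)
  simp only [smul_eq_mul] at hdiv hradial
  have houter : ∫ x in outer C, φ ‖x‖ * divergence (outer C) X x
      = ∫ x in C, φ ‖x‖ * divergence (outer C) X x :=
    (setIntegral_eq_of_subset_of_forall_sdiff_eq_zero hC.isClosed.measurableSet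
      Set.inter_subset_left fun x hx => by
        rw [hφ.eq_zero_of_le_one (not_lt.1 fun h => hx.2 ⟨hx.1, h⟩), zero_mul]).symm
  rw [← hC.integral_radial_mul hφ.deriv hX.continuousOn, houter, eq_sub_iff_add_eq',
    ← integral_add hdiv hradial]
  exact setIntegral_congr_fun hC.isClosed.measurableSet fun x hx =>
    (hφ.divergence_smul hC (hX.differentiableOn one_ne_zero) hx).symm

theorem IsRadialCutoff.integral_deriv_mul_flux_univ [Nontrivial E] (hφ : IsRadialCutoff 1 φ)
    (hX : ContDiffOn ℝ 1 X (outer Set.univ)) :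
    ∫ r, deriv φ r * flux (outer Set.univ) X r
      = - ∫ x in outer Set.univ, φ ‖x‖ * divergence (outer Set.univ) X x := by
  rw [isRegularCone_univ.integral_deriv_mul_flux hφ hX, setIntegral_univ,
    integral_divergence_univ_eq_zero volume (contDiffOn_univ.1 (hφ.contDiffOn_smul hX))
      (hφ.hasCompactSupport_smul X), zero_sub]

end Divergence

/-! ### The divergence theorem on the half-space -/

section HalfSpace

open scoped InnerProductSpace

theorem Icc_snoc_zero_eq {n : ℕ} {B : ℝ} (hB : 0 ≤ B) :
    Set.Icc (Fin.snoc (α := fun _ => ℝ) (fun _ : Fin n => -B) 0) (fun _ => B)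
      = {y | 0 ≤ y (Fin.last n)} ∩ {y | ‖y‖ ≤ B} := by
  ext y
  simp only [Set.mem_Icc, Pi.le_def, Set.mem_inter_iff, Set.mem_ofPred_eq,
    pi_norm_le_iff_of_nonneg hB, Fin.forall_fin_succ', Fin.snoc_castSucc, Fin.snoc_last,
    Real.norm_eq_abs, abs_le]
  grind

theorem integral_sum_fderiv_halfSpace_pi {n : ℕ} {f : (Fin (n + 1) → ℝ) → Fin (n + 1) → ℝ}
    {f' : (Fin (n + 1) → ℝ) → (Fin (n + 1) → ℝ) →L[ℝ] Fin (n + 1) → ℝ} {B : ℝ} (hB : 0 ≤ B)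
    (hf : ContinuousOn f {y | 0 ≤ y (Fin.last n)})
    (hf' : ∀ y, 0 < y (Fin.last n) → HasFDerivAt f (f' y) y)
    (hcont : ContinuousOn f' {y | 0 ≤ y (Fin.last n)})
    (hzero : ∀ y, B ≤ ‖y‖ → f y = 0) (hzero' : ∀ y, B ≤ ‖y‖ → f' y = 0) :
    ∫ y in {y | 0 ≤ y (Fin.last n)}, ∑ i, f' y (Pi.single i 1) i
      = - ∫ z : Fin n → ℝ, f (Fin.snoc (α := fun _ => ℝ) z 0) (Fin.last n) := by
  set lo : Fin (n + 1) → ℝ := Fin.snoc (α := fun _ => ℝ) (fun _ => -B) 0 with hlo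
  have hIcc := Icc_snoc_zero_eq (n := n) hB
  rw [← hlo] at hIcc
  have hlast : lo (Fin.last n) = 0 := Fin.snoc_last (α := fun _ => ℝ) 0 _
  have hcast : ∀ i : Fin n, lo i.castSucc = -B := fun i => Fin.snoc_castSucc (α := fun _ => ℝ) _ _ i
  have hsub : Set.Icc lo (fun _ => B) ⊆ {y | 0 ≤ y (Fin.last n)} :=
    hIcc.le.trans Set.inter_subset_left
  have hdiv : ContinuousOn (fun y => ∑ i, f' y (Pi.single i 1) i) {y | 0 ≤ y (Fin.last n)} := by
    fun_prop
  have hface : ∀ (i : Fin (n + 1)) (c : ℝ) (z : Fin n → ℝ), B ≤ |c| → f (i.insertNth c z) = 0 :=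
    fun i c z hc => hzero _ (hc.trans
      (by simpa using norm_le_pi_norm (i.insertNth (α := fun _ => ℝ) c z) i))
  have hbox := integral_divergence_of_hasFDerivAt_off_countable lo (fun _ => B)
    (fun i => Fin.lastCases (hlast.trans_le hB) (fun j => (hcast j).trans_le (by linarith)) i)
    f f' ∅ Set.countable_empty (hf.mono hsub)
    (fun y hy => hf' y (hlast ▸ (hy.1 (Fin.last n) (Set.mem_univ _)).1))
    ((hdiv.mono hsub).integrableOn_compact isCompact_Icc)
  rw [setIntegral_eq_of_subset_of_forall_sdiff_eq_zero (isClosed_le continuous_const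
    (by fun_prop)).measurableSet hsub fun y hy => ?_, hbox, Fin.sum_univ_castSucc]
  · simp only [hcast, hlast, hface _ _ _ (le_abs_self B), hface _ (-B) _ ((le_abs_self B).trans_eq
      (abs_neg B).symm), Pi.zero_apply, integral_zero, sub_self, Finset.sum_const_zero, zero_add,
      zero_sub]
    simp only [Fin.insertNth_last']
    rw [setIntegral_eq_integral_of_forall_compl_eq_zero fun z hz => ?_]
    rw [hzero _ (not_lt.1 fun h => hz ?_), Pi.zero_apply]
    have hbound := hIcc.ge ⟨(Fin.snoc_last (α := fun _ => ℝ) 0 z).ge, h.le⟩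
    refine ⟨fun i => ?_, fun i => ?_⟩
    · simpa [Fin.succAbove_last] using hbound.1 i.castSucc
    · simpa [Fin.succAbove_last] using hbound.2 i.castSucc
  · rw [hzero' y (not_lt.1 fun h => hy.2 (hIcc.ge ⟨hy.1, h.le⟩))]
    simp

theorem divergence_eq_sum {n : ℕ} {U : Set (EuclideanSpace ℝ (Fin n))}
    (X : EuclideanSpace ℝ (Fin n) → EuclideanSpace ℝ (Fin n)) (x : EuclideanSpace ℝ (Fin n)) :
    divergence U X x = ∑ i, fderivWithin ℝ X U x (EuclideanSpace.single i 1) i := by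
  change LinearMap.trace ℝ _ (fderivWithin ℝ X U x).toLinearMap = _
  rw [LinearMap.trace_eq_sum_inner _ (EuclideanSpace.basisFun (Fin n) ℝ)]
  simp [EuclideanSpace.inner_single_left]

theorem divergence_toLp {n : ℕ} {U : Set (EuclideanSpace ℝ (Fin n))}
    {x : EuclideanSpace ℝ (Fin n)} {F : Fin n → EuclideanSpace ℝ (Fin n) → ℝ}
    {F' : Fin n → EuclideanSpace ℝ (Fin n) →L[ℝ] ℝ} (hx : UniqueDiffWithinAt ℝ U x)
    (hF : ∀ i, HasFDerivWithinAt (F i) (F' i) U x) :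
    divergence U (fun y => WithLp.toLp 2 fun i => F i y) x
      = ∑ i, F' i (EuclideanSpace.single i 1) := by
  have hderiv : HasFDerivWithinAt (fun y => WithLp.toLp 2 fun i => F i y)
      ((PiLp.continuousLinearEquiv 2 ℝ fun _ : Fin n => ℝ).symm.toContinuousLinearMap ∘L
        ContinuousLinearMap.pi F') U x :=
    (hasFDerivWithinAt_piLp 2).2 hF
  rw [divergence_eq_sum, hderiv.fderivWithin hx]
  rfl

/-- The closed half-space `x₃ ≥ 0`. -/
def halfSpace : Set E3 := {x | 0 ≤ x 2}

theorem isClosed_halfSpace : IsClosed halfSpace :=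
  isClosed_le continuous_const (by fun_prop)

theorem convex_halfSpace : Convex ℝ halfSpace :=
  convex_halfSpace_ge (EuclideanSpace.proj (𝕜 := ℝ) (2 : Fin 3)).isLinear 0

theorem halfSpace_mem_nhds {x : E3} (hx : 0 < x 2) : halfSpace ∈ 𝓝 x :=
  mem_of_superset ((isOpen_lt continuous_const
    (by fun_prop : Continuous fun y : E3 => y 2)).mem_nhds hx) fun _ => le_of_lt (α := ℝ)

theorem isRegularCone_halfSpace : IsRegularCone halfSpace where
  isClosed := isClosed_halfSpace
  uniqueDiffOn := uniqueDiffOn_convex convex_halfSpace ⟨EuclideanSpace.single 2 1,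
    mem_interior_iff_mem_nhds.2 (halfSpace_mem_nhds (by simp))⟩
  smul_mem_iff _ hρ _ := mul_nonneg_iff_of_pos_left hρ

/-- The inclusion of the plane `x₃ = 0`, as a continuous linear map. -/
noncomputable def inPlaneL : E2 →L[ℝ] E3 :=
  LinearMap.toContinuousLinearMap
    { toFun := inPlane
      map_add' := fun z w => by ext i; fin_cases i <;> simp [inPlane]
      map_smul' := fun c z => by ext i; fin_cases i <;> simp [inPlane] }

theorem continuous_inPlane : Continuous inPlane := inPlaneL.continuous

theorem inPlane_apply_castSucc (z : E2) (i : Fin 2) : inPlane z i.castSucc = z i := by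
  fin_cases i <;> simp [inPlane]

theorem inPlane_apply_two (z : E2) : inPlane z 2 = 0 := by simp [inPlane]

theorem inPlane_toLp (z : Fin 2 → ℝ) :
    inPlane (WithLp.toLp 2 z) = WithLp.toLp 2 (Fin.snoc (α := fun _ => ℝ) z 0) := by
  ext i
  fin_cases i <;> simp [inPlane, Fin.snoc]

theorem norm_inPlane (z : E2) : ‖inPlane z‖ = ‖z‖ := by
  simp [EuclideanSpace.norm_eq, Fin.sum_univ_three, inPlane]

theorem inPlane_mem_outer_halfSpace {z : E2} (hz : z ∈ outer Set.univ) :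
    inPlane z ∈ outer halfSpace :=
  ⟨(inPlane_apply_two z).ge, hz.2.trans_eq (norm_inPlane z).symm⟩

theorem integral_divergence_halfSpace {X : E3 → E3} (hX : ContDiffOn ℝ 1 X halfSpace)
    (hs : HasCompactSupport X) :
    ∫ x in halfSpace, divergence halfSpace X x = - ∫ z : E2, X (inPlane z) 2 := by
  obtain ⟨B, hB, hXB⟩ := hs.isCompact.isBounded.subset_ball_lt 0 0
  let L : (Fin 3 → ℝ) ≃L[ℝ] E3 := (EuclideanSpace.equiv (Fin 3) ℝ).symm
  have hL : Set.MapsTo L {y | 0 ≤ y (Fin.last 2)} halfSpace := fun y hy => hy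
  have hnotMem : ∀ y : Fin 3 → ℝ, B ≤ ‖y‖ → L y ∉ tsupport X := fun y hy h =>
    hy.not_gt (((pi_norm_le_iff_of_nonneg (norm_nonneg _)).2 fun i =>
      PiLp.norm_apply_le (L y) i).trans_lt (mem_ball_zero_iff.1 (hXB h)))
  have hDX := hX.continuousOn_fderivWithin isRegularCone_halfSpace.uniqueDiffOn le_rfl
  have hpi := integral_sum_fderiv_halfSpace_pi (f := fun y => L.symm (X (L y)))
    (f' := fun y => (L.symm : E3 →L[ℝ] _) ∘L fderivWithin ℝ X halfSpace (L y) ∘L L) hB.le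
    (L.symm.continuous.comp_continuousOn (hX.continuousOn.comp L.continuous.continuousOn hL))
    (fun y hy => ?_) ?_
    (fun y hy => by simp only [image_eq_zero_of_notMem_tsupport (hnotMem y hy), map_zero])
    (fun y hy => by
      rw [(notMem_tsupport_iff_eventuallyEq.1 (hnotMem y hy)).filter_mono
        nhdsWithin_le_nhds |>.fderivWithin_eq (image_eq_zero_of_notMem_tsupport (hnotMem y hy))]
      simp)
  · have hme := (MeasurableEquiv.toLp 2 (Fin 3 → ℝ)).measurableEmbedding
    have hme' := (MeasurableEquiv.toLp 2 (Fin 2 → ℝ)).measurableEmbedding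
    rw [← (PiLp.volume_preserving_toLp (Fin 3)).setIntegral_preimage_emb hme,
      ← (PiLp.volume_preserving_toLp (Fin 2)).integral_comp hme']
    simp only [divergence_eq_sum, inPlane_toLp]
    exact hpi
  · have hLy : HasFDerivAt X (fderivWithin ℝ X halfSpace (L y)) (L y) :=
      ((hX.differentiableOn one_ne_zero) _ (hL hy.le)).hasFDerivWithinAt.hasFDerivAt
        (halfSpace_mem_nhds hy)
    exact L.symm.hasFDerivAt.comp y (hLy.comp y L.hasFDerivAt)
  · exact continuousOn_const.clm_comp ((hDX.comp L.continuous.continuousOn hL).clm_comp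
      continuousOn_const)

theorem IsRadialCutoff.integral_deriv_mul_flux_halfSpace {φ : ℝ → ℝ} (hφ : IsRadialCutoff 1 φ)
    {X : E3 → E3} (hX : ContDiffOn ℝ 1 X (outer halfSpace)) :
    ∫ r, deriv φ r * flux (outer halfSpace) X r
      = - (∫ z : E2, φ ‖z‖ * X (inPlane z) 2)
        - ∫ x in outer halfSpace, φ ‖x‖ * divergence (outer halfSpace) X x := by
  rw [isRegularCone_halfSpace.integral_deriv_mul_flux hφ hX,
    integral_divergence_halfSpace (hφ.contDiffOn_smul hX) (hφ.hasCompactSupport_smul X)]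
  simp only [norm_inPlane, PiLp.smul_apply, smul_eq_mul]

end HalfSpace

/-! ### Convergence of fluxes -/

section Convergence

/-- The filter of neighbourhoods of infinity in a subset of a normed space; in `ℝ³` it is
`atInfinity`. -/
abbrev coboundedWithin {E : Type*} [NormedAddCommGroup E] (U : Set E) : Filter E :=
  Bornology.cobounded E ⊓ 𝓟 U

section Tail

variable {E : Type*} [NormedAddCommGroup E] {U : Set E}

theorem hasBasis_coboundedWithin :
    (coboundedWithin U).HasBasis (fun _ : ℝ => True) fun R => U ∩ {x | R ≤ ‖x‖} := by
  simpa only [Set.inter_comm] using hasBasis_cobounded_norm.inf_principal U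

theorem eventually_mem_coboundedWithin : ∀ᶠ x in coboundedWithin U, x ∈ U :=
  mem_inf_of_right (mem_principal_self U)

theorem tendsto_norm_coboundedWithin : Tendsto (fun x : E => ‖x‖) (coboundedWithin U) atTop :=
  tendsto_norm_cobounded_atTop.mono_left inf_le_left

variable [MeasurableSpace E] {μ : Measure E} {h : E → ℝ}

theorem exists_integrableOn_of_integrableAtFilter
    (hh : IntegrableAtFilter h (coboundedWithin U) μ) :
    ∃ R, ∀ a, R ≤ a → IntegrableOn h (U ∩ {x | a ≤ ‖x‖}) μ := by
  obtain ⟨s, hs, hint⟩ := hh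
  obtain ⟨R, -, hR⟩ := hasBasis_coboundedWithin.mem_iff.1 hs
  exact ⟨R, fun a ha => hint.mono_set fun x hx => hR ⟨hx.1, ha.trans hx.2⟩⟩

/-- The integral of `|h|` over the part of `U` outside the ball of radius `a`. -/
noncomputable def tailIntegral (μ : Measure E) (U : Set E) (h : E → ℝ) (a : ℝ) : ℝ :=
  ∫ x in U ∩ {x | a ≤ ‖x‖}, |h x| ∂μ

theorem abs_setIntegral_comp_norm_mul_le {φ : ℝ → ℝ} {a : ℝ} (hφ : tsupport φ ⊆ Set.Ici a)
    (hφ01 : ∀ r, φ r ∈ Set.Icc (0 : ℝ) 1) (hU : MeasurableSet U)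
    (hh : IntegrableOn h (U ∩ {x | a ≤ ‖x‖}) μ) :
    |∫ x in U, φ ‖x‖ * h x ∂μ| ≤ tailIntegral μ U h a := by
  have htail : ∫ x in U, φ ‖x‖ * h x ∂μ = ∫ x in U ∩ {x | a ≤ ‖x‖}, φ ‖x‖ * h x ∂μ := by
    refine setIntegral_eq_of_subset_of_forall_sdiff_eq_zero hU Set.inter_subset_left fun x hx => ?_
    rw [image_eq_zero_of_notMem_tsupport fun h => hx.2 ⟨hx.1, hφ h⟩, zero_mul]
  rw [htail, ← Real.norm_eq_abs]
  refine norm_integral_le_of_norm_le hh.abs (Eventually.of_forall fun x => ?_)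
  rw [norm_mul, Real.norm_eq_abs, Real.norm_eq_abs, abs_of_nonneg (hφ01 _).1]
  exact mul_le_of_le_one_left (abs_nonneg _) (hφ01 _).2

variable [BorelSpace E]

theorem tendsto_tailIntegral (hU : MeasurableSet U)
    (hh : IntegrableAtFilter h (coboundedWithin U) μ) :
    Tendsto (tailIntegral μ U h) atTop (𝓝 0) := by
  obtain ⟨R, hR⟩ := exists_integrableOn_of_integrableAtFilter hh
  have hempty : (⋂ a : ℝ, U ∩ {x : E | a ≤ ‖x‖}) = ∅ :=
    Set.eq_empty_of_forall_notMem fun x hx => (lt_add_one ‖x‖).not_ge (Set.mem_iInter.1 hx _).2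
  have hlim := tendsto_setIntegral_of_antitone (μ := μ) (f := fun x => |h x|)
    (s := fun a : ℝ => U ∩ {x : E | a ≤ ‖x‖})
    (fun a => hU.inter (isClosed_le continuous_const continuous_norm).measurableSet)
    (fun a b hab x hx => ⟨hx.1, le_trans hab hx.2⟩) ⟨R, (hR R le_rfl).abs⟩
  rwa [hempty, setIntegral_empty] at hlim

end Tail

theorem exists_tendsto_flux_univ {E : Type*} [NormedAddCommGroup E] [InnerProductSpace ℝ E]
    [FiniteDimensional ℝ E] [Nontrivial E] [MeasurableSpace E] [BorelSpace E] {X : E → E}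
    (hX : ContDiffOn ℝ 1 X (outer Set.univ))
    (hdiv : IntegrableAtFilter (divergence (outer Set.univ) X) (coboundedWithin (outer Set.univ))) :
    ∃ L, Tendsto (flux (outer Set.univ) X) atTop (𝓝 L) := by
  have hC := isRegularCone_univ (E := E)
  obtain ⟨R, hR⟩ := exists_integrableOn_of_integrableAtFilter hdiv
  refine exists_tendsto_of_weak_bound (R := max R 1)
    ((hC.continuousOn_flux hX.continuousOn).mono (Set.Ioi_subset_Ioi (le_max_right _ _)))
    (tendsto_tailIntegral hC.measurableSet_outer hdiv) fun a ha φ hφ hφs hφa hφ01 => ?_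
  obtain ⟨hRa, h1a⟩ := max_lt_iff.1 ha
  have hcut : IsRadialCutoff 1 φ := ⟨hφ, hφs, hφa.trans (Set.Ici_subset_Ioi.2 h1a)⟩
  simp only [smul_eq_mul]
  rw [hcut.integral_deriv_mul_flux_univ hX, norm_neg]
  exact abs_setIntegral_comp_norm_mul_le hφa hφ01 hC.measurableSet_outer (hR a hRa.le)

theorem IsRadialCutoff.integrable_mul {φ Ψ : ℝ → ℝ} {k : WithTop ℕ∞} (hφ : IsRadialCutoff k φ)
    (hΨ : ContinuousOn Ψ (Set.Ioi 1)) : Integrable fun r => φ r * Ψ r := by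
  rw [← integrableOn_iff_integrable_of_support_subset (s := tsupport φ)]
  · exact (hφ.continuous.continuousOn.mul (hΨ.mono hφ.tsupport_subset)).integrableOn_compact
      hφ.hasCompactSupport
  · exact (Function.support_mul_subset_left _ _).trans (subset_tsupport φ)

variable {X : E3 → E3} {Y : E2 → E2}

theorem IsRadialCutoff.integral_deriv_mul_flux_add_flux {φ : ℝ → ℝ} (hφ : IsRadialCutoff 1 φ)
    (hX : ContDiffOn ℝ 1 X (outer halfSpace)) (hY : ContDiffOn ℝ 1 Y (outer Set.univ)) :
    ∫ r, deriv φ r * (flux (outer halfSpace) X r + flux (outer Set.univ) Y r)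
      = - (∫ x in outer halfSpace, φ ‖x‖ * divergence (outer halfSpace) X x)
        - ∫ z in outer Set.univ, φ ‖z‖ * (X (inPlane z) 2 + divergence (outer Set.univ) Y z) := by
  have hX2 : ContinuousOn (fun z => X (inPlane z) 2) (outer Set.univ) :=
    (EuclideanSpace.proj (𝕜 := ℝ) (2 : Fin 3)).continuous.comp_continuousOn
      (hX.continuousOn.comp continuous_inPlane.continuousOn
        fun z hz => inPlane_mem_outer_halfSpace hz)
  have hplane : ∫ z, φ ‖z‖ * X (inPlane z) 2 = ∫ z in outer Set.univ, φ ‖z‖ * X (inPlane z) 2 :=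
    (setIntegral_eq_integral_of_forall_compl_eq_zero fun z hz => by
      rw [hφ.eq_zero_of_le_one (not_lt.1 fun h => hz ⟨Set.mem_univ _, h⟩), zero_mul]).symm
  have hi1 := hφ.integrableOn_smul (μ := volume) isClosed_univ hX2
  have hi2 := hφ.integrableOn_smul (μ := volume) isClosed_univ
    (continuousOn_divergence isRegularCone_univ.uniqueDiffOn_outer hY)
  simp only [smul_eq_mul] at hi1 hi2
  simp only [mul_add]
  rw [integral_add
      (hφ.deriv.integrable_mul (isRegularCone_halfSpace.continuousOn_flux hX.continuousOn))
      (hφ.deriv.integrable_mul (isRegularCone_univ.continuousOn_flux hY.continuousOn)),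
    hφ.integral_deriv_mul_flux_halfSpace hX, hφ.integral_deriv_mul_flux_univ hY, hplane,
    integral_add (hi1.mono_set (Set.subset_univ _)) (hi2.mono_set (Set.subset_univ _))]
  ring

theorem exists_tendsto_flux_halfSpace_add_flux (hX : ContDiffOn ℝ 1 X (outer halfSpace))
    (hY : ContDiffOn ℝ 1 Y (outer Set.univ))
    (hdiv : IntegrableAtFilter (divergence (outer halfSpace) X)
      (coboundedWithin (outer halfSpace)))
    (hdiv' : IntegrableAtFilter (fun z => X (inPlane z) 2 + divergence (outer Set.univ) Y z)
      (coboundedWithin (outer Set.univ))) :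
    ∃ L, Tendsto (fun ρ => flux (outer halfSpace) X ρ + flux (outer Set.univ) Y ρ)
      atTop (𝓝 L) := by
  have hC := isRegularCone_halfSpace
  have hC' := isRegularCone_univ (E := E2)
  obtain ⟨R, hR⟩ := exists_integrableOn_of_integrableAtFilter hdiv
  obtain ⟨R', hR'⟩ := exists_integrableOn_of_integrableAtFilter hdiv'
  have htail := (tendsto_tailIntegral hC.measurableSet_outer hdiv).add
    (tendsto_tailIntegral hC'.measurableSet_outer hdiv')
  rw [add_zero] at htail
  refine exists_tendsto_of_weak_bound (R := max (max R R') 1)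
    (((hC.continuousOn_flux hX.continuousOn).add (hC'.continuousOn_flux hY.continuousOn)).mono
      (Set.Ioi_subset_Ioi (le_max_right _ _))) htail fun a ha φ hφ hφs hφa hφ01 => ?_
  obtain ⟨hRa, h1a⟩ := max_lt_iff.1 ha
  have hcut : IsRadialCutoff 1 φ := ⟨hφ, hφs, hφa.trans (Set.Ici_subset_Ioi.2 h1a)⟩
  simp only [smul_eq_mul]
  rw [hcut.integral_deriv_mul_flux_add_flux hX hY, Real.norm_eq_abs, ← neg_add', abs_neg]
  exact (abs_add_le _ _).trans (add_le_add
    (abs_setIntegral_comp_norm_mul_le hφa hφ01 hC.measurableSet_outer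
      (hR a ((le_max_left _ _).trans hRa.le)))
    (abs_setIntegral_comp_norm_mul_le hφa hφ01 hC'.measurableSet_outer
      (hR' a ((le_max_right _ _).trans hRa.le))))

end Convergence

/-! ### Decay at infinity -/

section Decay

variable {E F V W : Type*} [NormedAddCommGroup E] [NormedAddCommGroup F] [NormedAddCommGroup V]
  [NormedAddCommGroup W] {U : Set E} {p q : ℝ}

/-- `h = O(‖x‖ ^ p)` at infinity in `U`. -/
def DecayO (U : Set E) (p : ℝ) (h : E → F) : Prop :=
  h =O[coboundedWithin U] fun x => ‖x‖ ^ p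

theorem eventually_le_norm_coboundedWithin (R : ℝ) : ∀ᶠ x in coboundedWithin U, R ≤ ‖x‖ :=
  tendsto_norm_coboundedWithin.eventually_ge_atTop R

namespace DecayO

section Normed

variable {f g : E → F}

theorem add (hf : DecayO U p f) (hg : DecayO U p g) : DecayO U p fun x => f x + g x :=
  IsBigO.add hf hg

theorem sub (hf : DecayO U p f) (hg : DecayO U p g) : DecayO U p fun x => f x - g x :=
  IsBigO.sub hf hg

theorem sum {ι : Type*} {s : Finset ι} {f : ι → E → F} (hf : ∀ i ∈ s, DecayO U p (f i)) :
    DecayO U p fun x => ∑ i ∈ s, f i x :=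
  IsBigO.fun_sum hf

theorem mono (hf : DecayO U p f) (hpq : p ≤ q) : DecayO U q f := by
  refine IsBigO.trans hf (IsBigO.of_bound' ?_)
  filter_upwards [eventually_le_norm_coboundedWithin 1] with x hx
  rw [Real.norm_of_nonneg (by positivity), Real.norm_of_nonneg (by positivity)]
  exact Real.rpow_le_rpow_of_exponent_le hx hpq

theorem congr_eventually (hf : DecayO U p f) (h : f =ᶠ[coboundedWithin U] g) : DecayO U p g :=
  IsBigO.congr' hf h EventuallyEq.rfl

theorem congr (hf : DecayO U p f) (h : ∀ x ∈ U, f x = g x) : DecayO U p g :=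
  hf.congr_eventually (eventually_mem_coboundedWithin.mono h)

theorem const (c : F) : DecayO U 0 fun _ => c := by
  simp only [DecayO, Real.rpow_zero]
  exact isBigO_const_const c one_ne_zero _

theorem tendsto_zero (hf : DecayO U p f) (hp : p < 0) : Tendsto f (coboundedWithin U) (𝓝 0) := by
  refine IsBigO.trans_tendsto hf ?_
  simpa only [neg_neg, Function.comp_def] using
    (tendsto_rpow_neg_atTop (neg_pos.2 hp)).comp (tendsto_norm_coboundedWithin (U := U))

theorem of_sub_const {c : F} (h : DecayO U p fun x => f x - c) (hp : p ≤ 0) : DecayO U 0 f :=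
  ((h.mono hp).add (const c)).congr fun x _ => sub_add_cancel (f x) c

theorem tendsto_of_sub_const {c : F} (h : DecayO U p fun x => f x - c) (hp : p < 0) :
    Tendsto f (coboundedWithin U) (𝓝 c) :=
  tendsto_sub_nhds_zero_iff.1 (h.tendsto_zero hp)

end Normed

section Ring

variable {f g : E → ℝ}

theorem const_mul (c : ℝ) (hf : DecayO U p f) : DecayO U p fun x => c * f x :=
  IsBigO.const_mul_left hf c

theorem mul (hf : DecayO U p f) (hg : DecayO U q g) : DecayO U (p + q) fun x => f x * g x := by
  refine (IsBigO.mul hf hg).congr' EventuallyEq.rfl ?_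
  filter_upwards [eventually_le_norm_coboundedWithin 1] with x hx
  rw [Real.rpow_add (by linarith)]

end Ring

theorem of_apply {ι : Type*} [Fintype ι] {X : E → EuclideanSpace ℝ ι}
    (hX : ∀ i, DecayO U p fun x => X x i) : DecayO U p X :=
  ((PiLp.continuousLinearEquiv 2 ℝ fun _ : ι => ℝ).symm.isBigO_comp _ _).trans (isBigO_pi.2 hX)

variable [NormedSpace ℝ V] [NormedSpace ℝ W] {h : E → V} {c : V} {Θ : V → W}

theorem comp_sub (h0 : DecayO U p fun x => h x - c) (hp : p < 0) (hΘ : DifferentiableAt ℝ Θ c) :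
    DecayO U p fun x => Θ (h x) - Θ c :=
  (hΘ.isBigO_sub.comp_tendsto (h0.tendsto_of_sub_const hp)).trans h0

theorem fderivWithin_comp [NormedSpace ℝ E] {v : E} (hU : UniqueDiffOn ℝ U)
    (hh : DifferentiableOn ℝ h U) (hc : Tendsto h (coboundedWithin U) (𝓝 c))
    (hΘ : ContDiffAt ℝ 1 Θ c) (h1 : DecayO U p fun x => fderivWithin ℝ h U x v) :
    DecayO U p fun x => fderivWithin ℝ (fun y => Θ (h y)) U x v := by
  have hΘd : ∀ᶠ y in 𝓝 c, DifferentiableAt ℝ Θ y :=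
    (hΘ.eventually (by simp)).mono fun y hy => hy.differentiableAt one_ne_zero
  have hbdd : (fun x => fderiv ℝ Θ (h x)) =O[coboundedWithin U] fun _ => (1 : ℝ) :=
    ((hΘ.fderiv_right (m := 0) (by simp)).continuousAt.tendsto.comp hc).isBigO_one ℝ
  have hchain : DecayO U p fun x => fderiv ℝ Θ (h x) (fderivWithin ℝ h U x v) := by
    refine (IsBigO.of_bound' (Eventually.of_forall fun x => ?_)).trans
      ((hbdd.norm_left.mul h1.norm_left).congr_right fun x => one_mul _)
    rw [norm_mul, norm_norm, norm_norm]
    exact (fderiv ℝ Θ (h x)).le_opNorm _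
  refine hchain.congr_eventually ?_
  filter_upwards [eventually_mem_coboundedWithin, hc.eventually hΘd] with x hx hΘx
  have hcomp := (hΘx.hasFDerivAt.comp_hasFDerivWithinAt x (hh x hx).hasFDerivWithinAt).fderivWithin
    (hU x hx)
  exact (DFunLike.congr_fun hcomp v).symm

end DecayO

section Integrability

variable [NormedSpace ℝ E] [FiniteDimensional ℝ E] [MeasurableSpace E] [BorelSpace E]
  {μ : Measure E} [μ.IsAddHaarMeasure]

theorem DecayO.integrableAtFilter {h : E → F} (hh : DecayO U p h) (hU : MeasurableSet U)
    (hm : AEStronglyMeasurable h (μ.restrict U)) (hp : p < -Module.finrank ℝ E) :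
    IntegrableAtFilter h (coboundedWithin U) μ := by
  have hmeas : IsMeasurablyGenerated (coboundedWithin U) := by
    rw [coboundedWithin, Metric.cobounded_eq_cocompact]
    have := hU.principal_isMeasurablyGenerated
    infer_instance
  have hint : Integrable (fun x : E => (1 + ‖x‖) ^ p) μ := by
    simpa only [neg_neg] using integrable_one_add_norm (μ := μ) (lt_neg_of_lt_neg hp)
  refine IsBigO.integrableAtFilter (g := fun x => (1 + ‖x‖) ^ p) (hh.trans ?_)
    ⟨U, mem_inf_of_right (mem_principal_self U), hm⟩ (hint.integrableAtFilter _)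
  refine IsBigO.of_bound ((1 / 2) ^ p) ?_
  filter_upwards [eventually_le_norm_coboundedWithin 1] with x hx
  rw [Real.norm_of_nonneg (by positivity), Real.norm_of_nonneg (by positivity),
    ← Real.mul_rpow (by norm_num) (by positivity)]
  refine Real.rpow_le_rpow_of_nonpos (by positivity) (by linarith) ?_
  exact hp.le.trans (neg_nonpos.2 (Nat.cast_nonneg _))

theorem integrableAtFilter_of_decayO_sub {h k : E → F} (hU : MeasurableSet U)
    (hh : ContinuousOn h U) (hk : IntegrableOn k U μ) (hhk : DecayO U p fun x => h x - k x)
    (hp : p < -Module.finrank ℝ E) : IntegrableAtFilter h (coboundedWithin U) μ := by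
  have hsub := hhk.integrableAtFilter hU
    ((hh.aestronglyMeasurable hU).sub hk.aestronglyMeasurable) hp
  have hk' : IntegrableAtFilter k (coboundedWithin U) μ :=
    ⟨U, mem_inf_of_right (mem_principal_self U), hk⟩
  exact (hsub.add hk').congr (Eventually.of_forall fun x => sub_add_cancel (h x) (k x))

end Integrability

section Flux

variable {E : Type*} [NormedAddCommGroup E] [InnerProductSpace ℝ E] [FiniteDimensional ℝ E]
  [MeasurableSpace E] [BorelSpace E] {C : Set E} {p : ℝ} {X Y : E → E}

theorem flux_const_smul (U : Set E) (c : ℝ) (X : E → E) :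
    flux U (fun x => c • X x) = fun ρ => c * flux U X ρ := by
  ext ρ
  simp only [flux, inner_smul_right, integral_const_mul]
  ring

theorem IsRegularCone.flux_sub (hC : IsRegularCone C) (hX : ContinuousOn X (outer C))
    (hY : ContinuousOn Y (outer C)) {ρ : ℝ} (hρ : 1 < ρ) :
    flux (outer C) (fun x => X x - Y x) ρ = flux (outer C) X ρ - flux (outer C) Y ρ := by
  have hint : ∀ {Z : E → E}, ContinuousOn Z (outer C) → IntegrableOn
      (fun v : Metric.sphere (0 : E) 1 => inner ℝ (v : E) (Z (ρ • (v : E))))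
      {v | (v : E) ∈ C} (volume : Measure E).toSphere := fun hZ =>
    ContinuousOn.integrableOn_compact hC.isClosed_sphere_inter.isCompact <|
      continuous_subtype_val.continuousOn.inner <|
        hZ.comp (by fun_prop) fun v hv => hC.smul_mem_outer hρ hv
  simp only [flux, hC.setOf_smul_mem_outer hρ, inner_sub_right]
  rw [integral_sub (hint hX) (hint hY), mul_sub]

theorem IsRegularCone.norm_flux_le (hC : IsRegularCone C) {ρ c : ℝ} (hρ : 1 < ρ)
    (hX : ∀ x ∈ outer C, ‖x‖ = ρ → ‖X x‖ ≤ c) :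
    ‖flux (outer C) X ρ‖ ≤ ρ ^ (Module.finrank ℝ E - 1) *
      (c * (volume : Measure E).toSphere.real {v | (v : E) ∈ C}) := by
  have h0 : 0 < ρ := zero_lt_one.trans hρ
  rw [flux, hC.setOf_smul_mem_outer hρ, norm_mul, Real.norm_of_nonneg (by positivity)]
  refine mul_le_mul_of_nonneg_left ?_ (by positivity)
  refine norm_setIntegral_le_of_norm_le_const (measure_lt_top _ _) fun v hv => ?_
  have hnorm : ‖ρ • (v : E)‖ = ρ := by
    rw [norm_smul, norm_eq_of_mem_sphere, mul_one, Real.norm_of_nonneg h0.le]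
  calc ‖inner ℝ (v : E) (X (ρ • (v : E)))‖ ≤ ‖(v : E)‖ * ‖X (ρ • (v : E))‖ := norm_inner_le_norm _ _
    _ ≤ c := by
      rw [norm_eq_of_mem_sphere, one_mul]
      exact hX _ (hC.smul_mem_outer hρ hv) hnorm

theorem IsRegularCone.tendsto_flux_zero [Nontrivial E] (hC : IsRegularCone C)
    (hX : DecayO (outer C) p X) (hp : p < 1 - Module.finrank ℝ E) :
    Tendsto (flux (outer C) X) atTop (𝓝 0) := by
  obtain ⟨c, hc⟩ := hX.bound
  obtain ⟨R, -, hR⟩ := hasBasis_coboundedWithin.eventually_iff.1 hc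
  set m := (volume : Measure E).toSphere.real {v | (v : E) ∈ C}
  have hlim : Tendsto (fun ρ : ℝ => c * m * ρ ^ (p + (Module.finrank ℝ E - 1))) atTop (𝓝 0) := by
    have := (tendsto_rpow_neg_atTop (y := -(p + (Module.finrank ℝ E - 1)))
      (by linarith)).const_mul (c * m)
    simpa only [neg_neg, mul_zero] using this
  refine squeeze_zero_norm' ?_ hlim
  filter_upwards [eventually_gt_atTop 1, eventually_ge_atTop R] with ρ hρ hρR
  have h0 : 0 < ρ := zero_lt_one.trans hρ
  refine (hC.norm_flux_le hρ (c := c * ρ ^ p) fun x hx hxρ => ?_).trans_eq ?_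
  · have := hR ⟨hx, hρR.trans_eq hxρ.symm⟩
    rwa [hxρ, Real.norm_of_nonneg (by positivity)] at this
  · rw [Real.rpow_add h0, ← Nat.cast_pred Module.finrank_pos, Real.rpow_natCast]
    ring

theorem IsRegularCone.tendsto_flux_sub [Nontrivial E] (hC : IsRegularCone C)
    (hX : ContinuousOn X (outer C)) (hY : ContinuousOn Y (outer C))
    (hXY : DecayO (outer C) p fun x => X x - Y x) (hp : p < 1 - Module.finrank ℝ E) :
    Tendsto (fun ρ => flux (outer C) X ρ - flux (outer C) Y ρ) atTop (𝓝 0) := by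
  refine (hC.tendsto_flux_zero hXY hp).congr' ?_
  filter_upwards [eventually_gt_atTop 1] with ρ hρ using hC.flux_sub hX hY hρ

end Flux

end Decay

/-! ### Partial derivatives -/

section PartialDerivative

variable {U : Set E3} {x : E3} {h h' : E3 → ℝ} (k : Fin 3)

theorem pd_congr (heq : ∀ x ∈ U, h x = h' x) (hx : x ∈ U) : pd U k h x = pd U k h' x := by
  rw [pd, pd, fderivWithin_congr heq (heq x hx)]

theorem pd_add (hx : UniqueDiffWithinAt ℝ U x) (hh : DifferentiableWithinAt ℝ h U x)
    (hh' : DifferentiableWithinAt ℝ h' U x) :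
    pd U k (fun y => h y + h' y) x = pd U k h x + pd U k h' x := by
  simp [pd, fderivWithin_fun_add hx hh hh']

theorem pd_sub (hx : UniqueDiffWithinAt ℝ U x) (hh : DifferentiableWithinAt ℝ h U x)
    (hh' : DifferentiableWithinAt ℝ h' U x) :
    pd U k (fun y => h y - h' y) x = pd U k h x - pd U k h' x := by
  simp [pd, fderivWithin_fun_sub hx hh hh']

theorem pd_mul (hx : UniqueDiffWithinAt ℝ U x) (hh : DifferentiableWithinAt ℝ h U x)
    (hh' : DifferentiableWithinAt ℝ h' U x) :
    pd U k (fun y => h y * h' y) x = pd U k h x * h' x + h x * pd U k h' x := by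
  simp [pd, fderivWithin_fun_mul hx hh hh']
  ring

theorem pd_const_mul (hx : UniqueDiffWithinAt ℝ U x) (c : ℝ)
    (hh : DifferentiableWithinAt ℝ h U x) :
    pd U k (fun y => c * h y) x = c * pd U k h x := by
  simp [pd, fderivWithin_const_mul hx hh]

theorem pd_sum (hx : UniqueDiffWithinAt ℝ U x) {ι : Type*} {s : Finset ι} {h : ι → E3 → ℝ}
    (hh : ∀ i ∈ s, DifferentiableWithinAt ℝ (h i) U x) :
    pd U k (fun y => ∑ i ∈ s, h i y) x = ∑ i ∈ s, pd U k (h i) x := by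
  simp [pd, fderivWithin_fun_sum hx hh]

theorem contDiffOn_pd (hU : UniqueDiffOn ℝ U) (hh : ContDiffOn ℝ ∞ h U) :
    ContDiffOn ℝ ∞ (pd U k h) U :=
  (hh.fderivWithin hU (m := ∞) (by simp)).clm_apply contDiffOn_const

end PartialDerivative

/-! ### Smooth dependence of determinants and inverses -/

section Matrix

variable {E : Type*} [NormedAddCommGroup E] [NormedSpace ℝ E] {m : Type*} [Fintype m]
  [DecidableEq m] {A : E → Matrix m m ℝ} {s : Set E} {x : E} {k : WithTop ℕ∞}

theorem contDiffWithinAt_det (hA : ∀ i j, ContDiffWithinAt ℝ k (fun y => A y i j) s x) :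
    ContDiffWithinAt ℝ k (fun y => (A y).det) s x := by
  simp only [Matrix.det_apply]
  exact ContDiffWithinAt.sum fun σ _ =>
    (contDiffWithinAt_prod fun i _ => hA (σ i) i).const_smul _

theorem contDiffWithinAt_inv (hA : ∀ i j, ContDiffWithinAt ℝ k (fun y => A y i j) s x)
    (h0 : (A x).det ≠ 0) (i j : m) : ContDiffWithinAt ℝ k (fun y => (A y)⁻¹ i j) s x := by
  simp only [Matrix.inv_def, Matrix.smul_apply, Ring.inverse_eq_inv', smul_eq_mul,
    Matrix.adjugate_apply]
  refine ((contDiffWithinAt_det hA).inv h0).mul (contDiffWithinAt_det fun a b => ?_)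
  by_cases h : a = j
  · subst h
    simp only [Matrix.updateRow_self]
    exact contDiffWithinAt_const
  · simp only [Matrix.updateRow_ne h]
    exact hA a b

open scoped Matrix.Norms.Elementwise

theorem contDiffAt_inv_one (i j : m) : ContDiffAt ℝ k (fun A : Matrix m m ℝ => A⁻¹ i j) 1 :=
  contDiffWithinAt_inv (fun a b => (contDiff_apply_apply ℝ ℝ a b).contDiffAt) (by simp) i j

theorem contDiffAt_sqrt_det_one : ContDiffAt ℝ k (fun A : Matrix m m ℝ => √A.det) 1 := by
  have hdet : ContDiffAt ℝ k (fun A : Matrix m m ℝ => A.det) 1 :=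
    contDiffWithinAt_det fun a b => (contDiff_apply_apply ℝ ℝ a b).contDiffAt
  exact hdet.sqrt (by simp)

end Matrix

/-! ### Metrics in a coordinate region -/

section Metric

variable {U : Set E3} {G : E3 → Matrix (Fin 3) (Fin 3) ℝ} {q : ℝ}

/-- `G` is the matrix of a smooth Riemannian metric on a region `U` which is regular enough for
derivatives within `U` to be well defined. -/
structure IsSmoothMetric (U : Set E3) (G : E3 → Matrix (Fin 3) (Fin 3) ℝ) : Prop where
  uniqueDiffOn : UniqueDiffOn ℝ U
  contDiffOn : ∀ i j, ContDiffOn ℝ ∞ (fun x => G x i j) U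
  posDef : ∀ x ∈ U, (G x).PosDef

namespace IsSmoothMetric

theorem symm (hG : IsSmoothMetric U G) {x : E3} (hx : x ∈ U) (i j : Fin 3) :
    G x i j = G x j i :=
  (hG.posDef x hx).isHermitian.apply j i

theorem det_pos (hG : IsSmoothMetric U G) {x : E3} (hx : x ∈ U) : 0 < (G x).det :=
  (hG.posDef x hx).det_pos

theorem volumeDensity_pos (hG : IsSmoothMetric U G) {x : E3} (hx : x ∈ U) :
    0 < volumeDensity G x :=
  Real.sqrt_pos.2 (hG.det_pos hx)

theorem contDiffOn_inv (hG : IsSmoothMetric U G) (i j : Fin 3) :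
    ContDiffOn ℝ ∞ (fun x => (G x)⁻¹ i j) U := fun x hx =>
  contDiffWithinAt_inv (fun a b => hG.contDiffOn a b x hx) (hG.det_pos hx).ne' i j

theorem contDiffOn_volumeDensity (hG : IsSmoothMetric U G) :
    ContDiffOn ℝ ∞ (volumeDensity G) U := fun x hx =>
  (contDiffWithinAt_det fun a b => hG.contDiffOn a b x hx).sqrt (hG.det_pos hx).ne'

theorem contDiffOn_pd (hG : IsSmoothMetric U G) (k i j : Fin 3) :
    ContDiffOn ℝ ∞ (pd U k fun x => G x i j) U :=
  ConformalMass.contDiffOn_pd k hG.uniqueDiffOn (hG.contDiffOn i j)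

theorem differentiableWithinAt_pd (hG : IsSmoothMetric U G) {x : E3} (hx : x ∈ U)
    (k i j : Fin 3) : DifferentiableWithinAt ℝ (pd U k fun y => G y i j) U x :=
  (hG.contDiffOn_pd k i j).differentiableOn (by simp) x hx

end IsSmoothMetric

/-- Decay of the metric to the Euclidean one, together with its first and second derivatives, at
a given rate `q`. -/
structure DecaysAtRate (U : Set E3) (q : ℝ) (G : E3 → Matrix (Fin 3) (Fin 3) ℝ) : Prop where
  half_lt : 1 / 2 < q
  sub_one : ∀ i j, DecayO U (-q) fun x => G x i j - (1 : Matrix (Fin 3) (Fin 3) ℝ) i j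
  decayO_pd : ∀ k i j, DecayO U (-q - 1) (pd U k fun x => G x i j)
  decayO_pd_pd : ∀ l k i j, DecayO U (-q - 2) (pd U l (pd U k fun x => G x i j))

theorem DecaysToEuclidean.exists_decaysAtRate (h : DecaysToEuclidean U G) :
    ∃ q, DecaysAtRate U q G := by
  obtain ⟨q, hq, -, h⟩ := h
  exact ⟨q, hq, fun i j => (h i j).1, fun k i j => (h i j).2.1 k,
    fun l k i j => (h i j).2.2 k l⟩

namespace DecaysAtRate

theorem mono {q' : ℝ} (h : DecaysAtRate U q G) (hq' : 1 / 2 < q') (hle : q' ≤ q) :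
    DecaysAtRate U q' G where
  half_lt := hq'
  sub_one i j := (h.sub_one i j).mono (by linarith)
  decayO_pd k i j := (h.decayO_pd k i j).mono (by linarith)
  decayO_pd_pd l k i j := (h.decayO_pd_pd l k i j).mono (by linarith)

theorem rate_pos (h : DecaysAtRate U q G) : 0 < q := by linarith [h.half_lt]

section Composition

open scoped Matrix.Norms.Elementwise

variable {Θ : Matrix (Fin 3) (Fin 3) ℝ → ℝ}

theorem decayO_sub_one (h : DecaysAtRate U q G) : DecayO U (-q) fun x => G x - 1 :=
  isBigO_pi.2 fun i => isBigO_pi.2 (h.sub_one i)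

theorem decayO_comp_sub (h : DecaysAtRate U q G) (hΘ : ContDiffAt ℝ 1 Θ 1) :
    DecayO U (-q) fun x => Θ (G x) - Θ 1 :=
  h.decayO_sub_one.comp_sub (neg_lt_zero.2 h.rate_pos) (hΘ.differentiableAt one_ne_zero)

theorem decayO_pd_comp (h : DecaysAtRate U q G) (hG : IsSmoothMetric U G)
    (hΘ : ContDiffAt ℝ 1 Θ 1) (k : Fin 3) :
    DecayO U (-q - 1) (pd U k fun x => Θ (G x)) := by
  have hderiv : ∀ x ∈ U, HasFDerivWithinAt (F := Fin 3 → Fin 3 → ℝ) G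
      (ContinuousLinearMap.pi fun i => ContinuousLinearMap.pi fun j =>
        fderivWithin ℝ (fun y => G y i j) U x) U x := fun x hx =>
    hasFDerivWithinAt_pi.2 fun i => hasFDerivWithinAt_pi.2 fun j =>
      ((hG.contDiffOn i j).differentiableOn (by simp) x hx).hasFDerivWithinAt
  refine DecayO.fderivWithin_comp (V := Fin 3 → Fin 3 → ℝ) hG.uniqueDiffOn
    (fun x hx => (hderiv x hx).differentiableWithinAt)
    (h.decayO_sub_one.tendsto_of_sub_const (neg_lt_zero.2 h.rate_pos)) hΘ ?_
  refine DecayO.congr (f := fun x i j => pd U k (fun y => G y i j) x) ?_ fun x hx => ?_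
  · exact isBigO_pi.2 fun i => isBigO_pi.2 (h.decayO_pd k i)
  · rw [(hderiv x hx).fderivWithin (hG.uniqueDiffOn x hx)]
    rfl

theorem inv_sub_one (h : DecaysAtRate U q G) (i j : Fin 3) :
    DecayO U (-q) fun x => (G x)⁻¹ i j - (1 : Matrix (Fin 3) (Fin 3) ℝ) i j := by
  simpa only [inv_one] using h.decayO_comp_sub (contDiffAt_inv_one i j)

theorem decayO_pd_inv (h : DecaysAtRate U q G) (hG : IsSmoothMetric U G) (k i j : Fin 3) :
    DecayO U (-q - 1) (pd U k fun x => (G x)⁻¹ i j) :=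
  h.decayO_pd_comp hG (contDiffAt_inv_one i j) k

theorem volumeDensity_sub_one (h : DecaysAtRate U q G) :
    DecayO U (-q) fun x => volumeDensity G x - 1 := by
  simpa only [Matrix.det_one, Real.sqrt_one, volumeDensity] using
    h.decayO_comp_sub contDiffAt_sqrt_det_one

end Composition

end DecaysAtRate

end Metric

/-! ### Linearization of the curvature -/

section Curvature

variable {U : Set E3} {G : E3 → Matrix (Fin 3) (Fin 3) ℝ} {q : ℝ}

/-- The lowered Christoffel symbols `∂_i g_jl + ∂_j g_il - ∂_l g_ij`, without the factor `½`. -/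
noncomputable def lowered (U : Set E3) (G : E3 → Matrix (Fin 3) (Fin 3) ℝ) (i j l : Fin 3)
    (x : E3) : ℝ :=
  pd U i (fun y => G y j l) x + pd U j (fun y => G y i l) x - pd U l (fun y => G y i j) x

theorem christoffel_eq (k i j : Fin 3) (x : E3) :
    christoffel U G k i j x = 1 / 2 * ∑ l, (G x)⁻¹ k l * lowered U G i j l x := rfl

theorem sum_one_mul {ι R : Type*} [Fintype ι] [DecidableEq ι] [NonAssocSemiring R] (k : ι)
    (v : ι → R) : ∑ l, (1 : Matrix ι ι R) k l * v l = v k := by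
  simp [Matrix.one_apply]

/-- The part of the Ricci curvature that is linear in the second derivatives of the metric. -/
noncomputable def linearRicci (U : Set E3) (G : E3 → Matrix (Fin 3) (Fin 3) ℝ) (i j : Fin 3)
    (x : E3) : ℝ :=
  ∑ k, (1 / 2 * pd U k (lowered U G i j k) x - 1 / 2 * pd U j (lowered U G i k k) x)

/-- The vector field with the components of the mass one-form, so that its Euclidean flux is the
one in the definition of the mass. -/
noncomputable def massField (U : Set E3) (G : E3 → Matrix (Fin 3) (Fin 3) ℝ) (x : E3) : E3 :=
  WithLp.toLp 2 fun j => massForm U G j x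

namespace IsSmoothMetric

theorem contDiffOn_lowered (hG : IsSmoothMetric U G) (i j l : Fin 3) :
    ContDiffOn ℝ ∞ (lowered U G i j l) U :=
  ((hG.contDiffOn_pd i j l).add (hG.contDiffOn_pd j i l)).sub (hG.contDiffOn_pd l i j)

theorem pd_lowered (hG : IsSmoothMetric U G) (m i j l : Fin 3) {x : E3} (hx : x ∈ U) :
    pd U m (lowered U G i j l) x
      = pd U m (pd U i fun y => G y j l) x + pd U m (pd U j fun y => G y i l) x
        - pd U m (pd U l fun y => G y i j) x := by
  have hu := hG.uniqueDiffOn x hx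
  have hd := hG.differentiableWithinAt_pd hx
  unfold lowered
  rw [pd_sub m hu ((hd _ _ _).fun_add (hd _ _ _)) (hd _ _ _), pd_add m hu (hd _ _ _) (hd _ _ _)]

theorem pd_christoffel (hG : IsSmoothMetric U G) (m k i j : Fin 3) {x : E3} (hx : x ∈ U) :
    pd U m (christoffel U G k i j) x
      = 1 / 2 * ∑ l, (pd U m (fun y => (G y)⁻¹ k l) x * lowered U G i j l x
        + (G x)⁻¹ k l * pd U m (lowered U G i j l) x) := by
  have hu := hG.uniqueDiffOn x hx
  have hinv : ∀ l, DifferentiableWithinAt ℝ (fun y => (G y)⁻¹ k l) U x := fun l =>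
    (hG.contDiffOn_inv k l).differentiableOn (by simp) x hx
  have hlow : ∀ l, DifferentiableWithinAt ℝ (lowered U G i j l) U x := fun l =>
    (hG.contDiffOn_lowered i j l).differentiableOn (by simp) x hx
  rw [funext (christoffel_eq (U := U) (G := G) k i j), pd_const_mul m hu _
      (DifferentiableWithinAt.fun_sum fun l _ => (hinv l).fun_mul (hlow l)),
    pd_sum m hu fun l _ => (hinv l).fun_mul (hlow l)]
  simp only [fun l => pd_mul m hu (hinv l) (hlow l)]

theorem contDiffOn_massForm (hG : IsSmoothMetric U G) (j : Fin 3) :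
    ContDiffOn ℝ ∞ (massForm U G j) U :=
  ContDiffOn.sum fun i _ => (hG.contDiffOn_pd i i j).sub (hG.contDiffOn_pd j i i)

theorem contDiffOn_massField (hG : IsSmoothMetric U G) : ContDiffOn ℝ ∞ (massField U G) U :=
  contDiffOn_piLp' 2 hG.contDiffOn_massForm

theorem pd_massForm (hG : IsSmoothMetric U G) (k j : Fin 3) {x : E3} (hx : x ∈ U) :
    pd U k (massForm U G j) x
      = ∑ i, (pd U k (pd U i fun y => G y i j) x - pd U k (pd U j fun y => G y i i) x) := by
  have hu := hG.uniqueDiffOn x hx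
  have hd := hG.differentiableWithinAt_pd hx
  unfold massForm
  rw [pd_sum k hu fun i _ => (hd i i j).fun_sub (hd j i i)]
  simp only [fun i => pd_sub k hu (hd i i j) (hd j i i)]

theorem divergence_massField (hG : IsSmoothMetric U G) {x : E3} (hx : x ∈ U) :
    divergence U (massField U G) x = ∑ i, linearRicci U G i i x := by
  unfold massField
  rw [divergence_toLp (hG.uniqueDiffOn x hx) fun j =>
    ((hG.contDiffOn_massForm j).differentiableOn (by simp) x hx).hasFDerivWithinAt]
  change ∑ j, pd U j (massForm U G j) x = _
  simp only [hG.pd_massForm _ _ hx, linearRicci, hG.pd_lowered _ _ _ _ hx, Fin.sum_univ_three]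
  ring

end IsSmoothMetric

namespace DecaysAtRate

theorem decayO_lowered (h : DecaysAtRate U q G) (i j l : Fin 3) :
    DecayO U (-q - 1) (lowered U G i j l) :=
  ((h.decayO_pd i j l).add (h.decayO_pd j i l)).sub (h.decayO_pd l i j)

theorem decayO_pd_lowered (h : DecaysAtRate U q G) (hG : IsSmoothMetric U G) (m i j l : Fin 3) :
    DecayO U (-q - 2) (pd U m (lowered U G i j l)) :=
  (((h.decayO_pd_pd m i j l).add (h.decayO_pd_pd m j i l)).sub (h.decayO_pd_pd m l i j)).congr
    fun _ hx => (hG.pd_lowered m i j l hx).symm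

theorem christoffel_sub (h : DecaysAtRate U q G) (k i j : Fin 3) :
    DecayO U (-2 * q - 1) fun x => christoffel U G k i j x - 1 / 2 * lowered U G i j k x := by
  have hrem : DecayO U (-2 * q - 1) fun x => 1 / 2 * ∑ l,
      ((G x)⁻¹ k l - (1 : Matrix (Fin 3) (Fin 3) ℝ) k l) * lowered U G i j l x :=
    .const_mul _ <| .sum fun l _ =>
      ((h.inv_sub_one k l).mul (h.decayO_lowered i j l)).mono (by linarith)
  refine hrem.congr fun x _ => ?_
  simp only [sub_mul, Finset.sum_sub_distrib, sum_one_mul, christoffel_eq]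
  ring

theorem decayO_christoffel (h : DecaysAtRate U q G) (k i j : Fin 3) :
    DecayO U (-q - 1) (christoffel U G k i j) :=
  (((h.christoffel_sub k i j).mono (by linarith [h.half_lt])).add
    ((h.decayO_lowered i j k).const_mul (1 / 2))).congr fun x _ => by ring

theorem pd_christoffel_sub (h : DecaysAtRate U q G) (hG : IsSmoothMetric U G)
    (m k i j : Fin 3) :
    DecayO U (-2 * q - 2) fun x => pd U m (christoffel U G k i j) x
      - 1 / 2 * pd U m (lowered U G i j k) x := by
  have hrem : DecayO U (-2 * q - 2) fun x => 1 / 2 * ∑ l,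
      (pd U m (fun y => (G y)⁻¹ k l) x * lowered U G i j l x
        + ((G x)⁻¹ k l - (1 : Matrix (Fin 3) (Fin 3) ℝ) k l)
          * pd U m (lowered U G i j l) x) := by
    refine .const_mul _ (.sum fun l _ => .add ?_ ?_)
    · exact ((h.decayO_pd_inv hG m k l).mul (h.decayO_lowered i j l)).mono (by linarith)
    · exact ((h.inv_sub_one k l).mul (h.decayO_pd_lowered hG m i j l)).mono (by linarith)
  refine hrem.congr fun x hx => ?_
  simp only [hG.pd_christoffel m k i j hx, sub_mul, Finset.sum_sub_distrib,
    Finset.sum_add_distrib, sum_one_mul]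
  ring

theorem ricci_sub (h : DecaysAtRate U q G) (hG : IsSmoothMetric U G) (i j : Fin 3) :
    DecayO U (-2 * q - 2) fun x => ricci U G i j x - linearRicci U G i j x := by
  have hΓ : ∀ a b c d e f, DecayO U (-2 * q - 2) fun x =>
      christoffel U G a b c x * christoffel U G d e f x := fun a b c d e f =>
    ((h.decayO_christoffel a b c).mul (h.decayO_christoffel d e f)).mono (by linarith)
  have hrem : DecayO U (-2 * q - 2) fun x =>
      ∑ k, ((pd U k (christoffel U G k i j) x - 1 / 2 * pd U k (lowered U G i j k) x)
        - (pd U j (christoffel U G k i k) x - 1 / 2 * pd U j (lowered U G i k k) x))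
      + ∑ k, ∑ l, (christoffel U G k k l x * christoffel U G l i j x
        - christoffel U G k j l x * christoffel U G l i k x) :=
    .add
      (.sum fun k _ => (h.pd_christoffel_sub hG k k i j).sub (h.pd_christoffel_sub hG j k i k))
      (.sum fun k _ => .sum fun l _ => (hΓ k k l l i j).sub (hΓ k j l l i k))
  refine hrem.congr fun x _ => ?_
  simp only [ricci, linearRicci, Finset.sum_sub_distrib]
  ring

theorem decayO_linearRicci (h : DecaysAtRate U q G) (hG : IsSmoothMetric U G) (i j : Fin 3) :
    DecayO U (-q - 2) (linearRicci U G i j) :=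
  .sum fun k _ => ((h.decayO_pd_lowered hG k i j k).const_mul _).sub
    ((h.decayO_pd_lowered hG j i k k).const_mul _)

theorem decayO_ricci (h : DecaysAtRate U q G) (hG : IsSmoothMetric U G) (i j : Fin 3) :
    DecayO U (-q - 2) (ricci U G i j) :=
  (((h.ricci_sub hG i j).mono (by linarith [h.half_lt])).add (h.decayO_linearRicci hG i j)).congr
    fun x _ => by ring

theorem scalarCurvature_sub (h : DecaysAtRate U q G) (hG : IsSmoothMetric U G) :
    DecayO U (-2 * q - 2) fun x => scalarCurvature U G x - ∑ i, linearRicci U G i i x := by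
  have hrem : DecayO U (-2 * q - 2) fun x =>
      ∑ i, ((∑ j, ((G x)⁻¹ i j - (1 : Matrix (Fin 3) (Fin 3) ℝ) i j) * ricci U G i j x)
        + (ricci U G i i x - linearRicci U G i i x)) :=
    .sum fun i _ => (DecayO.sum fun j _ =>
      ((h.inv_sub_one i j).mul (h.decayO_ricci hG i j)).mono (by linarith)).add (h.ricci_sub hG i i)
  refine hrem.congr fun x _ => ?_
  simp only [sub_mul, Finset.sum_sub_distrib, Finset.sum_add_distrib, sum_one_mul, scalarCurvature]
  ring

theorem divergence_massField_sub (h : DecaysAtRate U q G) (hG : IsSmoothMetric U G) :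
    DecayO U (-2 * q - 2) fun x =>
      divergence U (massField U G) x - scalarCurvature U G x * volumeDensity G x := by
  have hlin : DecayO U (-q - 2) fun x => ∑ i, linearRicci U G i i x :=
    .sum fun i _ => h.decayO_linearRicci hG i i
  have hscal := (h.scalarCurvature_sub hG).mul
    (h.volumeDensity_sub_one.of_sub_const (neg_nonpos.2 h.rate_pos.le))
  have hdens := hlin.mul h.volumeDensity_sub_one
  refine (((hscal.mono (q := -2 * q - 2) (by linarith)).add
    (hdens.mono (by linarith))).const_mul (-1)).congr fun x hx => ?_
  rw [hG.divergence_massField hx]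
  ring

end DecaysAtRate

end Curvature

/-! ### The mean curvature of the boundary plane -/

section MeanCurvature

variable {U : Set E3} {G : E3 → Matrix (Fin 3) (Fin 3) ℝ} {q : ℝ}

/-- The coefficients of the Christoffel symbols `Γ^3_αβ` in the mean curvature density of the
boundary plane, as functions of the matrix of the metric. -/
noncomputable def boundaryWeight (α β : Fin 2) (A : Matrix (Fin 3) (Fin 3) ℝ) : ℝ :=
  (A.submatrix Fin.castSucc Fin.castSucc)⁻¹ α β *
    √(A.submatrix (Fin.castSucc : Fin 2 → Fin 3) Fin.castSucc).det / √(A⁻¹ 2 2)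

theorem meanCurvature_mul_sqrt_det (z : E2) :
    meanCurvature U G z * √(inducedMetric G z).det
      = ∑ α : Fin 2, ∑ β : Fin 2, boundaryWeight α β (G (inPlane z)) *
        christoffel U G 2 α.castSucc β.castSucc (inPlane z) := by
  simp only [meanCurvature, Finset.sum_mul, boundaryWeight, inducedMetric]
  refine Finset.sum_congr rfl fun α _ => Finset.sum_congr rfl fun β _ => ?_
  ring

theorem submatrix_castSucc_one :
    (1 : Matrix (Fin 3) (Fin 3) ℝ).submatrix (Fin.castSucc : Fin 2 → Fin 3) Fin.castSucc = 1 :=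
  Matrix.submatrix_one _ (Fin.castSucc_injective 2)

theorem boundaryWeight_one (α β : Fin 2) :
    boundaryWeight α β 1 = (1 : Matrix (Fin 2) (Fin 2) ℝ) α β := by
  simp [boundaryWeight, submatrix_castSucc_one]

open scoped Matrix.Norms.Elementwise in
theorem contDiffAt_boundaryWeight_one (α β : Fin 2) : ContDiffAt ℝ 1 (boundaryWeight α β) 1 := by
  have hsub : ∀ a b : Fin 2, ContDiffAt ℝ 1 (fun A : Matrix (Fin 3) (Fin 3) ℝ =>
      A.submatrix (Fin.castSucc : Fin 2 → Fin 3) Fin.castSucc a b) 1 := fun a b =>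
    (contDiff_apply_apply ℝ ℝ a.castSucc b.castSucc).contDiffAt
  refine .div (.mul ?_ (.sqrt ?_ ?_)) (.sqrt (contDiffAt_inv_one 2 2) ?_) ?_
  · exact contDiffWithinAt_inv hsub (by simp [submatrix_castSucc_one]) α β
  · exact contDiffWithinAt_det hsub
  all_goals simp [submatrix_castSucc_one]

theorem IsSmoothMetric.massForm_add_sum_pd (hG : IsSmoothMetric U G) {x : E3} (hx : x ∈ U) :
    massForm U G 2 x + ∑ α : Fin 2, pd U α.castSucc (fun y => G y 2 α.castSucc) x
      = ∑ α : Fin 2, lowered U G α.castSucc α.castSucc 2 x := by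
  have hsymm : ∀ k j, pd U k (fun y => G y 2 j) x = pd U k (fun y => G y j 2) x := fun k j =>
    pd_congr k (fun y hy => hG.symm hy 2 j) hx
  simp only [massForm, lowered, hsymm, Fin.sum_univ_three, Fin.sum_univ_two, Fin.castSucc_zero,
    Fin.castSucc_one]
  ring

theorem DecaysAtRate.massForm_add_sub_christoffel (h : DecaysAtRate U q G)
    (hG : IsSmoothMetric U G) :
    DecayO U (-2 * q - 1) fun x =>
      (massForm U G 2 x + ∑ α : Fin 2, pd U α.castSucc (fun y => G y 2 α.castSucc) x)
        - 2 * ∑ α : Fin 2, ∑ β : Fin 2, boundaryWeight α β (G x) *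
          christoffel U G 2 α.castSucc β.castSucc x := by
  have hrem : DecayO U (-2 * q - 1) fun x => (-2) * ∑ α : Fin 2,
      ((∑ β : Fin 2, (boundaryWeight α β (G x) - boundaryWeight α β 1) *
          christoffel U G 2 α.castSucc β.castSucc x)
        + (christoffel U G 2 α.castSucc α.castSucc x
          - 1 / 2 * lowered U G α.castSucc α.castSucc 2 x)) := by
    refine .const_mul _ (.sum fun α _ => .add (.sum fun β _ => ?_) (h.christoffel_sub _ _ _))
    exact ((h.decayO_comp_sub (contDiffAt_boundaryWeight_one α β)).mul
      (h.decayO_christoffel _ _ _)).mono (by linarith)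
  refine hrem.congr fun x hx => ?_
  rw [hG.massForm_add_sum_pd hx]
  simp only [boundaryWeight_one, Fin.sum_univ_two, Matrix.one_apply_eq, Matrix.one_apply_ne,
    ne_eq, zero_ne_one, one_ne_zero, not_false_eq_true]
  ring

end MeanCurvature

/-! ### Convergence of the mass fluxes -/

theorem exterior_eq_outer : exterior = outer Set.univ := (Set.univ_inter _).symm

theorem halfExterior_eq_outer : halfExterior = outer halfSpace := rfl

theorem massFlux_eq_flux (U : Set E3) (G : E3 → Matrix (Fin 3) (Fin 3) ℝ) :
    massFlux U G = flux U (massField U G) := by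
  ext ρ
  simp [massFlux, flux, massField, PiLp.inner_apply]

section MassFlux

variable {U : Set E3} {G : E3 → Matrix (Fin 3) (Fin 3) ℝ} {q : ℝ}

theorem DecaysAtRate.integrableAtFilter_divergence_massField (hq : DecaysAtRate U q G)
    (hG : IsSmoothMetric U G) (hU : MeasurableSet U)
    (hR : IntegrableForVolume U G (scalarCurvature U G)) :
    IntegrableAtFilter (divergence U (massField U G)) (coboundedWithin U) :=
  integrableAtFilter_of_decayO_sub hU
    (continuousOn_divergence hG.uniqueDiffOn (hG.contDiffOn_massField.of_le (by simp))) hR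
    (hq.divergence_massField_sub hG)
    (by rw [finrank_euclideanSpace_fin]; push_cast; linarith [hq.half_lt])

theorem exists_tendsto_massFlux (hG : IsSmoothMetric exterior G) (hq : DecaysAtRate exterior q G)
    (hR : IntegrableForVolume exterior G (scalarCurvature exterior G)) :
    ∃ L, Tendsto (massFlux exterior G) atTop (𝓝 L) := by
  rw [exterior_eq_outer] at *
  rw [massFlux_eq_flux]
  exact exists_tendsto_flux_univ (hG.contDiffOn_massField.of_le (by simp))
    (hq.integrableAtFilter_divergence_massField hG isRegularCone_univ.measurableSet_outer hR)

end MassFlux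

section BoundaryPlane

variable {G : E3 → Matrix (Fin 3) (Fin 3) ℝ} {q : ℝ}

theorem inPlaneL_single (α : Fin 2) :
    inPlaneL (EuclideanSpace.single α 1) = EuclideanSpace.single α.castSucc 1 := by
  change inPlane _ = _
  ext i
  fin_cases α <;> fin_cases i <;> simp [inPlane]

theorem tendsto_inPlane_coboundedWithin :
    Tendsto inPlane (coboundedWithin (outer Set.univ)) (coboundedWithin (outer halfSpace)) := by
  refine tendsto_inf.2 ⟨?_, tendsto_principal.2 ?_⟩
  · rw [← tendsto_norm_atTop_iff_cobounded]
    simpa only [norm_inPlane] using tendsto_norm_coboundedWithin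
  · exact eventually_mem_coboundedWithin.mono fun z => inPlane_mem_outer_halfSpace

theorem DecayO.comp_inPlane {F : Type*} [NormedAddCommGroup F] {p : ℝ} {h : E3 → F}
    (hh : DecayO (outer halfSpace) p h) :
    DecayO (outer Set.univ) p fun z : E2 => h (inPlane z) :=
  (hh.comp_tendsto tendsto_inPlane_coboundedWithin).congr_right fun z => by
    rw [Function.comp_apply, norm_inPlane]

/-- The tangential vector field on the boundary plane whose flux is the circle term. -/
noncomputable def planeField (G : E3 → Matrix (Fin 3) (Fin 3) ℝ) (z : E2) : E2 :=
  WithLp.toLp 2 fun α => G (inPlane z) 2 α.castSucc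

theorem circleTerm_eq_flux (G : E3 → Matrix (Fin 3) (Fin 3) ℝ) {ρ : ℝ} (hρ : 1 < ρ) :
    circleTerm G ρ = flux (outer Set.univ) (planeField G) ρ := by
  simp [circleTerm, isRegularCone_univ.flux_outer _ hρ, planeField, PiLp.inner_apply,
    Fin.sum_univ_castSucc (n := 2), inPlane_apply_castSucc, show Fin.last 2 = 2 from rfl,
    inPlane_apply_two, -Fin.castSucc_zero]

namespace IsSmoothMetric

theorem contDiffOn_planeField (hG : IsSmoothMetric (outer halfSpace) G) :
    ContDiffOn ℝ ∞ (planeField G) (outer Set.univ) :=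
  contDiffOn_piLp' 2 fun α => (hG.contDiffOn 2 α.castSucc).comp inPlaneL.contDiff.contDiffOn
    fun _ => inPlane_mem_outer_halfSpace

theorem divergence_planeField (hG : IsSmoothMetric (outer halfSpace) G) {z : E2}
    (hz : z ∈ outer Set.univ) :
    divergence (outer Set.univ) (planeField G) z
      = ∑ α : Fin 2, pd (outer halfSpace) α.castSucc (fun y => G y 2 α.castSucc) (inPlane z) := by
  refine (divergence_toLp (isRegularCone_univ.uniqueDiffOn_outer z hz) fun α =>
    ((hG.contDiffOn 2 α.castSucc).differentiableOn (by simp) _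
      (inPlane_mem_outer_halfSpace hz)).hasFDerivWithinAt.comp z inPlaneL.hasFDerivWithinAt
        fun _ => inPlane_mem_outer_halfSpace).trans (Finset.sum_congr rfl fun α _ => ?_)
  rw [ContinuousLinearMap.comp_apply, inPlaneL_single]
  rfl

theorem continuousOn_massForm_add_divergence_planeField
    (hG : IsSmoothMetric (outer halfSpace) G) :
    ContinuousOn (fun z => massField (outer halfSpace) G (inPlane z) 2
      + divergence (outer Set.univ) (planeField G) z) (outer Set.univ) :=
  ((hG.contDiffOn_massForm 2).continuousOn.comp continuous_inPlane.continuousOn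
    fun _ => inPlane_mem_outer_halfSpace).add
  (continuousOn_divergence isRegularCone_univ.uniqueDiffOn_outer
    (hG.contDiffOn_planeField.of_le (by simp)))

end IsSmoothMetric

namespace DecaysAtRate

theorem massForm_add_divergence_planeField_sub (hq : DecaysAtRate (outer halfSpace) q G)
    (hG : IsSmoothMetric (outer halfSpace) G) :
    DecayO (outer Set.univ) (-2 * q - 1) fun z =>
      massField (outer halfSpace) G (inPlane z) 2 + divergence (outer Set.univ) (planeField G) z
        - 2 * (meanCurvature (outer halfSpace) G z * √(inducedMetric G z).det) := by
  refine (hq.massForm_add_sub_christoffel hG).comp_inPlane.congr fun z hz => ?_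
  rw [hG.divergence_planeField hz, meanCurvature_mul_sqrt_det]
  rfl

theorem integrableAtFilter_massForm_add_divergence_planeField
    (hq : DecaysAtRate (outer halfSpace) q G) (hG : IsSmoothMetric (outer halfSpace) G)
    (hH : IntegrableForArea G (meanCurvature (outer halfSpace) G)) :
    IntegrableAtFilter (fun z => massField (outer halfSpace) G (inPlane z) 2
        + divergence (outer Set.univ) (planeField G) z) (coboundedWithin (outer Set.univ)) := by
  rw [IntegrableForArea, ← Set.univ_inter {z : E2 | 1 < ‖z‖}] at hH
  exact integrableAtFilter_of_decayO_sub isRegularCone_univ.measurableSet_outer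
    hG.continuousOn_massForm_add_divergence_planeField (hH.const_mul 2)
    (hq.massForm_add_divergence_planeField_sub hG)
    (by rw [finrank_euclideanSpace_fin]; push_cast; linarith [hq.half_lt])

end DecaysAtRate

theorem exists_tendsto_massFlux_add_circleTerm (hG : IsSmoothMetric halfExterior G)
    (hq : DecaysAtRate halfExterior q G)
    (hR : IntegrableForVolume halfExterior G (scalarCurvature halfExterior G))
    (hH : IntegrableForArea G (meanCurvature halfExterior G)) :
    ∃ L, Tendsto (fun ρ => massFlux halfExterior G ρ + circleTerm G ρ) atTop (𝓝 L) := by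
  rw [halfExterior_eq_outer] at *
  obtain ⟨L, hL⟩ := exists_tendsto_flux_halfSpace_add_flux
    (hG.contDiffOn_massField.of_le (by simp)) (hG.contDiffOn_planeField.of_le (by simp))
    (hq.integrableAtFilter_divergence_massField hG isRegularCone_halfSpace.measurableSet_outer hR)
    (hq.integrableAtFilter_massForm_add_divergence_planeField hG hH)
  refine ⟨L, hL.congr' ?_⟩
  filter_upwards [eventually_gt_atTop 1] with ρ hρ
  rw [circleTerm_eq_flux G hρ, massFlux_eq_flux]

end BoundaryPlane

/-! ### Conformal changes of the metric -/

section Factor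

variable {U : Set E3} {F F' : E3 → ℝ} {q : ℝ}

/-- A positive smooth function on `U` that tends to `1` at rate `q`, with first derivatives
decaying at rate `q + 1`: the conformal factors considered here. -/
structure DecayingFactor (U : Set E3) (q : ℝ) (F : E3 → ℝ) : Prop where
  contDiffOn : ContDiffOn ℝ ∞ F U
  pos : ∀ x ∈ U, 0 < F x
  sub_one : DecayO U (-q) fun x => F x - 1
  decayO_pd : ∀ k, DecayO U (-q - 1) (pd U k F)

namespace DecayingFactor

theorem mono {q' : ℝ} (hF : DecayingFactor U q F) (h : q' ≤ q) : DecayingFactor U q' F where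
  contDiffOn := hF.contDiffOn
  pos := hF.pos
  sub_one := hF.sub_one.mono (by linarith)
  decayO_pd k := (hF.decayO_pd k).mono (by linarith)

theorem congr (hF : DecayingFactor U q F) (h : ∀ x ∈ U, F x = F' x) : DecayingFactor U q F' where
  contDiffOn := hF.contDiffOn.congr fun x hx => (h x hx).symm
  pos x hx := h x hx ▸ hF.pos x hx
  sub_one := hF.sub_one.congr fun x hx => by rw [h x hx]
  decayO_pd k := (hF.decayO_pd k).congr fun _ hx => pd_congr k h hx

theorem mul (hF : DecayingFactor U q F) (hF' : DecayingFactor U q F') (hU : UniqueDiffOn ℝ U)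
    (hq : 0 ≤ q) : DecayingFactor U q fun x => F x * F' x where
  contDiffOn := hF.contDiffOn.mul hF'.contDiffOn
  pos x hx := mul_pos (hF.pos x hx) (hF'.pos x hx)
  sub_one := by
    have hprod := (hF.sub_one.mul hF'.sub_one).mono (q := -q) (by linarith)
    exact ((hprod.add hF.sub_one).add hF'.sub_one).congr fun x _ => by ring
  decayO_pd k := by
    have hbdd := hF.sub_one.of_sub_const (neg_nonpos.2 hq)
    have hbdd' := hF'.sub_one.of_sub_const (neg_nonpos.2 hq)
    refine DecayO.congr (f := fun x => pd U k F x * F' x + F x * pd U k F' x) ?_ fun x hx =>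
      (pd_mul k (hU x hx) (hF.contDiffOn.differentiableOn (by simp) x hx)
        (hF'.contDiffOn.differentiableOn (by simp) x hx)).symm
    exact (((hF.decayO_pd k).mul hbdd').mono (by linarith)).add
      ((hbdd.mul (hF'.decayO_pd k)).mono (by linarith))

theorem rpow (hF : DecayingFactor U q F) (hU : UniqueDiffOn ℝ U) (hq : 0 < q) (s : ℝ) :
    DecayingFactor U q fun x => F x ^ s where
  contDiffOn x hx := (hF.contDiffOn x hx).rpow_const_of_ne (hF.pos x hx).ne'
  pos x hx := Real.rpow_pos_of_pos (hF.pos x hx) s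
  sub_one := by
    simpa only [Real.one_rpow] using hF.sub_one.comp_sub (neg_lt_zero.2 hq)
      (Real.differentiableAt_rpow_const_of_ne s one_ne_zero)
  decayO_pd k := DecayO.fderivWithin_comp hU (hF.contDiffOn.differentiableOn (by simp))
    (hF.sub_one.tendsto_of_sub_const (neg_lt_zero.2 hq))
    (Real.contDiffAt_rpow_const_of_ne (p := s) one_ne_zero) (hF.decayO_pd k)

end DecayingFactor

theorem pd_rpow {k : Fin 3} {x : E3} (hx : UniqueDiffWithinAt ℝ U x)
    (hF : DifferentiableWithinAt ℝ F U x) (hne : F x ≠ 0) (s : ℝ) :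
    pd U k (fun y => F y ^ s) x = s * F x ^ (s - 1) * pd U k F x := by
  simp [pd, (hF.hasFDerivWithinAt.rpow_const (p := s) (Or.inl hne)).fderivWithin hx]

end Factor

section ConformalChange

variable {U : Set E3} {G : E3 → Matrix (Fin 3) (Fin 3) ℝ} {F : E3 → ℝ} {q : ℝ}

theorem IsSmoothMetric.smul {P : E3 → ℝ} (hG : IsSmoothMetric U G) (hP : ContDiffOn ℝ ∞ P U)
    (hpos : ∀ x ∈ U, 0 < P x) : IsSmoothMetric U fun x => P x • G x where
  uniqueDiffOn := hG.uniqueDiffOn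
  contDiffOn i j := hP.mul (hG.contDiffOn i j)
  posDef x hx := (hG.posDef x hx).smul (hpos x hx)

theorem DecaysAtRate.decayingFactor_diag (hq : DecaysAtRate U q G) (hG : IsSmoothMetric U G)
    (i : Fin 3) : DecayingFactor U q fun x => G x i i where
  contDiffOn := hG.contDiffOn i i
  pos x hx := (hG.posDef x hx).diag_pos
  sub_one := by simpa only [Matrix.one_apply_eq] using hq.sub_one i i
  decayO_pd k := hq.decayO_pd k i i

theorem DecaysAtRate.decayingFactor_of_rpow_smul {a : ℝ} (ha : a ≠ 0) (hG : IsSmoothMetric U G)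
    (hq : DecaysAtRate U q G) (hq' : DecaysAtRate U q fun x => F x ^ a • G x)
    (hF : ContDiffOn ℝ ∞ F U) (hpos : ∀ x ∈ U, 0 < F x) : DecayingFactor U q F := by
  have hq0 : 0 < q := hq.rate_pos
  have hFa : ContDiffOn ℝ ∞ (fun x => F x ^ a) U := fun x hx =>
    (hF x hx).rpow_const_of_ne (hpos x hx).ne'
  have hG' : IsSmoothMetric U fun x => F x ^ a • G x :=
    hG.smul hFa fun x hx => Real.rpow_pos_of_pos (hpos x hx) a
  have hU := hG.uniqueDiffOn
  have hquot := (hq'.decayingFactor_diag hG' 0).mul ((hq.decayingFactor_diag hG 0).rpow hU hq0 (-1))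
    hU hq0.le
  refine (hquot.rpow hU hq0 a⁻¹).congr fun x hx => ?_
  have hne : G x 0 0 ≠ 0 := (hG.posDef x hx).diag_pos.ne'
  rw [Matrix.smul_apply, smul_eq_mul, Real.rpow_neg_one, mul_inv_cancel_right₀ hne,
    Real.rpow_rpow_inv (hpos x hx).le ha]

/-- The Euclidean gradient of a function on `U`. -/
noncomputable def euclideanGradient (U : Set E3) (F : E3 → ℝ) (x : E3) : E3 :=
  WithLp.toLp 2 fun j => pd U j F x

theorem contDiffOn_euclideanGradient (hU : UniqueDiffOn ℝ U) (hF : ContDiffOn ℝ ∞ F U) :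
    ContDiffOn ℝ ∞ (euclideanGradient U F) U :=
  contDiffOn_piLp' 2 fun j => contDiffOn_pd j hU hF

namespace DecayingFactor

theorem pd_rpow_smul_sub (hF : DecayingFactor U q F) (hG : IsSmoothMetric U G)
    (hq : DecaysAtRate U q G) (s : ℝ) (k a b : Fin 3) :
    DecayO U (-2 * q - 1) fun x => pd U k (fun y => (F y ^ s • G y) a b) x
      - (pd U k (fun y => G y a b) x
        + s * ((1 : Matrix (Fin 3) (Fin 3) ℝ) a b * pd U k F x)) := by
  have hq0 : 0 < q := hq.rate_pos
  have hs := hF.rpow hG.uniqueDiffOn hq0 s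
  have hs' := hF.rpow hG.uniqueDiffOn hq0 (s - 1)
  have hFG : DecayO U (-q) fun x =>
      F x ^ (s - 1) * G x a b - (1 : Matrix (Fin 3) (Fin 3) ℝ) a b := by
    have hprod := hs'.sub_one.mul ((hq.sub_one a b).of_sub_const (neg_nonpos.2 hq.rate_pos.le))
    exact ((hprod.mono (q := -q) (by linarith)).add (hq.sub_one a b)).congr fun x _ => by ring
  have hpdG := (hs.sub_one.mul (hq.decayO_pd k a b)).mono (q := -2 * q - 1) (by linarith)
  have hpdF := (((hF.decayO_pd k).mul hFG).const_mul s).mono (q := -2 * q - 1) (by linarith)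
  refine (hpdG.add hpdF).congr fun x hx => ?_
  have hu := hG.uniqueDiffOn x hx
  have hleibniz : pd U k (fun y => (F y ^ s • G y) a b) x
      = s * F x ^ (s - 1) * pd U k F x * G x a b + F x ^ s * pd U k (fun y => G y a b) x := by
    simp only [Matrix.smul_apply, smul_eq_mul]
    rw [pd_mul k hu (hs.contDiffOn.differentiableOn (by simp) x hx)
      ((hG.contDiffOn a b).differentiableOn (by simp) x hx),
      pd_rpow hu (hF.contDiffOn.differentiableOn (by simp) x hx) (hF.pos x hx).ne']
  rw [hleibniz]
  ring

theorem massField_rpow_smul_sub (hF : DecayingFactor U q F) (hG : IsSmoothMetric U G)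
    (hq : DecaysAtRate U q G) (s : ℝ) :
    DecayO U (-2 * q - 1) fun x => massField U (fun x => F x ^ s • G x) x
      - (massField U G x - (2 * s) • euclideanGradient U F x) := by
  refine DecayO.of_apply fun j => ?_
  have hsum := DecayO.sum (s := Finset.univ) fun i _ =>
    (hF.pd_rpow_smul_sub hG hq s i i j).sub (hF.pd_rpow_smul_sub hG hq s j i i)
  refine hsum.congr fun x _ => ?_
  have hone : ∑ i, (1 : Matrix (Fin 3) (Fin 3) ℝ) i j * pd U i F x = pd U j F x := by
    simp [Matrix.one_apply]
  simp only [massField, massForm, euclideanGradient, PiLp.sub_apply, PiLp.smul_apply, smul_eq_mul,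
    Finset.sum_sub_distrib, Finset.sum_add_distrib, ← Finset.mul_sum, hone, Matrix.one_apply_eq,
    one_mul, Finset.sum_const, Finset.card_univ, Fintype.card_fin, nsmul_eq_mul, Nat.cast_ofNat]
  ring

theorem tendsto_massFlux_rpow_smul_sub {C : Set E3} (hC : IsRegularCone C)
    (hF : DecayingFactor (outer C) q F) (hG : IsSmoothMetric (outer C) G)
    (hq : DecaysAtRate (outer C) q G) (s : ℝ) :
    Tendsto (fun ρ => massFlux (outer C) (fun x => F x ^ s • G x) ρ
      - (massFlux (outer C) G ρ - s * (2 * flux (outer C) (euclideanGradient (outer C) F) ρ)))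
      atTop (𝓝 0) := by
  have hs := hF.rpow hG.uniqueDiffOn hq.rate_pos s
  have hGs := (hG.smul hs.contDiffOn hs.pos).contDiffOn_massField.continuousOn
  have hGc := hG.contDiffOn_massField.continuousOn
  have hFc : ContinuousOn (fun x => (2 * s) • euclideanGradient (outer C) F x) (outer C) :=
    ((contDiffOn_euclideanGradient hG.uniqueDiffOn hF.contDiffOn).const_smul (2 * s)).continuousOn
  refine (hC.tendsto_flux_sub hGs (hGc.fun_sub hFc)
    (hF.massField_rpow_smul_sub hG hq s) ?_).congr' ?_
  · rw [finrank_euclideanSpace_fin]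
    push_cast
    linarith [hq.half_lt]
  · filter_upwards [eventually_gt_atTop 1] with ρ hρ
    rw [massFlux_eq_flux, massFlux_eq_flux, hC.flux_sub hGc hFc hρ, flux_const_smul]
    ring

theorem planeField_rpow_smul_sub (hF : DecayingFactor (outer halfSpace) q F)
    (hG : IsSmoothMetric (outer halfSpace) G) (hq : DecaysAtRate (outer halfSpace) q G) (s : ℝ) :
    DecayO (outer Set.univ) (-2 * q) fun z =>
      planeField (fun x => F x ^ s • G x) z - planeField G z := by
  have hs := hF.rpow hG.uniqueDiffOn hq.rate_pos s
  refine DecayO.of_apply fun α => DecayO.comp_inPlane (h := fun x =>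
    (F x ^ s • G x) 2 α.castSucc - G x 2 α.castSucc) ?_
  refine ((hs.sub_one.mul (hq.sub_one 2 α.castSucc)).mono (by linarith)).congr fun x _ => ?_
  have hne : (2 : Fin 3) ≠ α.castSucc := (Fin.castSucc_lt_last α).ne'
  rw [Matrix.one_apply_ne hne, Matrix.smul_apply, smul_eq_mul]
  ring

theorem tendsto_circleTerm_rpow_smul_sub (hF : DecayingFactor (outer halfSpace) q F)
    (hG : IsSmoothMetric (outer halfSpace) G) (hq : DecaysAtRate (outer halfSpace) q G) (s : ℝ) :
    Tendsto (fun ρ => circleTerm (fun x => F x ^ s • G x) ρ - circleTerm G ρ) atTop (𝓝 0) := by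
  have hs := hF.rpow hG.uniqueDiffOn hq.rate_pos s
  refine (isRegularCone_univ.tendsto_flux_sub
    (hG.smul hs.contDiffOn hs.pos).contDiffOn_planeField.continuousOn
    hG.contDiffOn_planeField.continuousOn (hF.planeField_rpow_smul_sub hG hq s) ?_).congr' ?_
  · rw [finrank_euclideanSpace_fin]
    push_cast
    linarith [hq.half_lt]
  · filter_upwards [eventually_gt_atTop 1] with ρ hρ
    rw [circleTerm_eq_flux _ hρ, circleTerm_eq_flux _ hρ]

end DecayingFactor

end ConformalChange

/-! ### Masses of conformal metrics in coordinates -/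

section Gradient

theorem sum_sq_le_sum_mul_mul {ι : Type*} [Fintype ι] [DecidableEq ι] {A : Matrix ι ι ℝ} {ε : ℝ}
    (hε : 0 ≤ ε) (hA : ∀ i j, |A i j - (1 : Matrix ι ι ℝ) i j| ≤ ε) (v : ι → ℝ) :
    (1 - ε * Fintype.card ι) * ∑ i, v i ^ 2 ≤ ∑ i, ∑ j, A i j * v i * v j := by
  have hone : ∑ i, ∑ j, (1 : Matrix ι ι ℝ) i j * v i * v j = ∑ i, v i ^ 2 := by
    simp [Matrix.one_apply, sq]
  have herr : ∑ i, ∑ j, ((1 : Matrix ι ι ℝ) i j * v i * v j - A i j * v i * v j)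
      ≤ ε * (Fintype.card ι * ∑ i, v i ^ 2) := by
    calc ∑ i, ∑ j, ((1 : Matrix ι ι ℝ) i j * v i * v j - A i j * v i * v j)
        ≤ ∑ i, ∑ j, ε * (|v i| * |v j|) := by
          refine Finset.sum_le_sum fun i _ => Finset.sum_le_sum fun j _ => ?_
          rw [← sub_mul, ← sub_mul, mul_assoc, ← abs_mul]
          refine (le_abs_self _).trans ?_
          rw [abs_mul, abs_sub_comm]
          exact mul_le_mul_of_nonneg_right (hA i j) (abs_nonneg _)
      _ = ε * (∑ i, |v i|) ^ 2 := by
          rw [sq, Finset.sum_mul_sum, Finset.mul_sum]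
          exact Finset.sum_congr rfl fun i _ => (Finset.mul_sum _ _ _).symm
      _ ≤ ε * (Fintype.card ι * ∑ i, v i ^ 2) := by
          refine mul_le_mul_of_nonneg_left ?_ hε
          simpa only [sq_abs, Finset.card_univ] using
            sq_sum_le_card_mul_sum_sq (s := Finset.univ) (f := fun i => |v i|)
  simp only [Finset.sum_sub_distrib, hone] at herr
  linarith

variable {U : Set E3} {G : E3 → Matrix (Fin 3) (Fin 3) ℝ} {F : E3 → ℝ} {q : ℝ}

theorem DecaysAtRate.eventually_abs_pd_le_gradientNorm (hq : DecaysAtRate U q G) (F : E3 → ℝ)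
    (k : Fin 3) : ∀ᶠ x in coboundedWithin U, |pd U k F x| ≤ 2 * gradientNorm U G F x := by
  have hclose : ∀ᶠ x in coboundedWithin U, ∀ i j,
      |(G x)⁻¹ i j - (1 : Matrix (Fin 3) (Fin 3) ℝ) i j| ≤ 1 / 4 := by
    refine eventually_all.2 fun i => eventually_all.2 fun j => ?_
    have hlim := ((hq.inv_sub_one i j).tendsto_zero (neg_lt_zero.2 hq.rate_pos)).abs
    rw [abs_zero] at hlim
    exact hlim.eventually_le_const (by norm_num)
  filter_upwards [hclose] with x hx
  have hlower := sum_sq_le_sum_mul_mul (by norm_num) hx fun i => pd U i F x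
  rw [Fintype.card_fin] at hlower
  push_cast at hlower
  have hk : pd U k F x ^ 2 ≤ ∑ i, pd U i F x ^ 2 :=
    Finset.single_le_sum (f := fun i => pd U i F x ^ 2) (fun i _ => sq_nonneg _)
      (Finset.mem_univ k)
  refine abs_le_of_sq_le_sq ?_ (mul_nonneg zero_le_two (Real.sqrt_nonneg _))
  rw [gradientNorm, mul_pow, Real.sq_sqrt (by linarith [sq_nonneg (pd U k F x)])]
  linarith [sq_nonneg (pd U k F x)]

theorem DecaysAtRate.decayO_pd_of_gradientNorm (hq : DecaysAtRate U q G) {p : ℝ}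
    (h : DecayO U p fun x => ‖x‖ * gradientNorm U G F x) (k : Fin 3) :
    DecayO U (p - 1) (pd U k F) := by
  have hnorm : DecayO U (p - 1) (gradientNorm U G F) := by
    have hinv : DecayO U (-1) fun x : E3 => ‖x‖ ^ (-1 : ℝ) := isBigO_refl _ _
    refine ((hinv.mul h).mono (q := p - 1) (by linarith)).congr_eventually ?_
    filter_upwards [eventually_le_norm_coboundedWithin 1] with x hx
    rw [Real.rpow_neg_one, inv_mul_cancel_left₀ (by positivity)]
  refine IsBigO.trans (IsBigO.of_bound 2 ?_) hnorm
  filter_upwards [hq.eventually_abs_pd_le_gradientNorm F k] with x hx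
  rwa [Real.norm_eq_abs, gradientNorm, Real.norm_of_nonneg (Real.sqrt_nonneg _)]

/-- The vector field `√(det g) ∇^g F`, whose divergence is the density of `Δ_g F`. -/
noncomputable def gradientField (U : Set E3) (G : E3 → Matrix (Fin 3) (Fin 3) ℝ) (F : E3 → ℝ)
    (x : E3) : E3 :=
  WithLp.toLp 2 fun i => ∑ j, volumeDensity G x * (G x)⁻¹ i j * pd U j F x

theorem IsSmoothMetric.contDiffOn_gradientField_apply (hG : IsSmoothMetric U G)
    (hF : ContDiffOn ℝ ∞ F U) (i : Fin 3) :
    ContDiffOn ℝ ∞ (fun x => gradientField U G F x i) U := by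
  change ContDiffOn ℝ ∞ (fun x => ∑ j, volumeDensity G x * (G x)⁻¹ i j * pd U j F x) U
  exact ContDiffOn.sum fun j _ => (hG.contDiffOn_volumeDensity.mul (hG.contDiffOn_inv i j)).mul
    (ConformalMass.contDiffOn_pd j hG.uniqueDiffOn hF)

theorem IsSmoothMetric.divergence_gradientField (hG : IsSmoothMetric U G)
    (hF : ContDiffOn ℝ ∞ F U) {x : E3} (hx : x ∈ U) :
    divergence U (gradientField U G F) x = laplacian U G F x * volumeDensity G x := by
  rw [laplacian, mul_comm, mul_inv_cancel_left₀ (hG.volumeDensity_pos hx).ne']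
  exact divergence_toLp (hG.uniqueDiffOn x hx) fun i =>
    ((hG.contDiffOn_gradientField_apply hF i).differentiableOn (by simp) x hx).hasFDerivWithinAt

theorem DecayingFactor.gradientField_sub (hF : DecayingFactor U q F) (hq : DecaysAtRate U q G) :
    DecayO U (-2 * q - 1) fun x => gradientField U G F x - euclideanGradient U F x := by
  refine DecayO.of_apply fun i => ?_
  have hcoeff : ∀ j, DecayO U (-q) fun x =>
      volumeDensity G x * (G x)⁻¹ i j - (1 : Matrix (Fin 3) (Fin 3) ℝ) i j := fun j => by
    have hprod := hq.volumeDensity_sub_one.mul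
      ((hq.inv_sub_one i j).of_sub_const (neg_nonpos.2 hq.rate_pos.le))
    exact ((hprod.mono (q := -q) (by linarith)).add (hq.inv_sub_one i j)).congr
      fun x _ => by ring
  have hsum : DecayO U (-2 * q - 1) fun x => ∑ j,
      (volumeDensity G x * (G x)⁻¹ i j - (1 : Matrix (Fin 3) (Fin 3) ℝ) i j) * pd U j F x :=
    DecayO.sum fun j _ => ((hcoeff j).mul (hF.decayO_pd j)).mono (by linarith)
  refine hsum.congr fun x _ => ?_
  simp only [sub_mul, Finset.sum_sub_distrib, sum_one_mul, gradientField, euclideanGradient,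
    PiLp.sub_apply]

end Gradient

section Masses

variable {G : E3 → Matrix (Fin 3) (Fin 3) ℝ} {F : E3 → ℝ} {q : ℝ}

theorem DecayingFactor.exists_tendsto_flux_euclideanGradient (hF : DecayingFactor exterior q F)
    (hG : IsSmoothMetric exterior G) (hq : DecaysAtRate exterior q G)
    (hΔ : IntegrableForVolume exterior G (laplacian exterior G F)) :
    ∃ N, Tendsto (flux exterior (euclideanGradient exterior F)) atTop (𝓝 N) := by
  rw [exterior_eq_outer] at *
  have hC := isRegularCone_univ (E := E3)
  have hV : ContDiffOn ℝ ∞ (gradientField (outer Set.univ) G F) (outer Set.univ) :=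
    contDiffOn_piLp' 2 (hG.contDiffOn_gradientField_apply hF.contDiffOn)
  have hdiv : IntegrableOn (divergence (outer Set.univ) (gradientField (outer Set.univ) G F))
      (outer Set.univ) :=
    IntegrableOn.congr_fun hΔ (fun x hx => (hG.divergence_gradientField hF.contDiffOn hx).symm)
      hC.measurableSet_outer
  obtain ⟨N, hN⟩ := exists_tendsto_flux_univ (hV.of_le (by simp))
    ⟨_, mem_inf_of_right (mem_principal_self _), hdiv⟩
  have hsub := hC.tendsto_flux_sub hV.continuousOn
    (contDiffOn_euclideanGradient hG.uniqueDiffOn hF.contDiffOn).continuousOn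
    (hF.gradientField_sub hq)
    (by rw [finrank_euclideanSpace_fin]; push_cast; linarith [hq.half_lt])
  exact ⟨N, by simpa using hN.sub hsub⟩

theorem tendsto_sub_const_mul_of_tendsto_sub {α : Type*} {l : Filter α} {Ψ Φ N : α → ℝ}
    {A n s : ℝ} (hsub : Tendsto (fun ρ => Φ ρ - (Ψ ρ - s * N ρ)) l (𝓝 0))
    (hΨ : Tendsto Ψ l (𝓝 A)) (hN : Tendsto N l (𝓝 n)) : Tendsto Φ l (𝓝 (A - s * n)) := by
  simpa using hsub.add (hΨ.sub (hN.const_mul s))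

theorem tendsto_slope_of_tendsto_sub {α : Type*} {l : Filter α} {Ψ Φ N : α → ℝ} {A B s : ℝ}
    (hs : s ≠ 0) (hsub : Tendsto (fun ρ => Φ ρ - (Ψ ρ - s * N ρ)) l (𝓝 0))
    (hΨ : Tendsto Ψ l (𝓝 A)) (hΦ : Tendsto Φ l (𝓝 B)) :
    Tendsto N l (𝓝 (s⁻¹ * (0 - B + A))) :=
  (((hsub.sub hΦ).add hΨ).const_mul s⁻¹).congr fun ρ => by field_simp; ring

theorem DecayingFactor.exists_tendsto_massFlux_rpow_smul (hF : DecayingFactor exterior q F)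
    (hG : IsSmoothMetric exterior G) (hq : DecaysAtRate exterior q G)
    (hR : IntegrableForVolume exterior G (scalarCurvature exterior G))
    (hΔ : IntegrableForVolume exterior G (laplacian exterior G F)) :
    ∃ A n, Tendsto (massFlux exterior G) atTop (𝓝 A) ∧
      ∀ s : ℝ, Tendsto (massFlux exterior fun x => F x ^ s • G x) atTop (𝓝 (A - s * n)) := by
  obtain ⟨A, hA⟩ := exists_tendsto_massFlux hG hq hR
  obtain ⟨N, hN⟩ := hF.exists_tendsto_flux_euclideanGradient hG hq hΔ
  refine ⟨A, 2 * N, hA, fun s => ?_⟩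
  rw [exterior_eq_outer] at *
  exact tendsto_sub_const_mul_of_tendsto_sub
    (hF.tendsto_massFlux_rpow_smul_sub isRegularCone_univ hG hq s) hA (hN.const_mul 2)

theorem DecayingFactor.exists_tendsto_massFlux_add_circleTerm_rpow_smul {a A B : ℝ} (ha : a ≠ 0)
    (hF : DecayingFactor halfExterior q F) (hG : IsSmoothMetric halfExterior G)
    (hq : DecaysAtRate halfExterior q G)
    (hA : Tendsto (fun ρ => massFlux halfExterior G ρ + circleTerm G ρ) atTop (𝓝 A))
    (hB : Tendsto (fun ρ => massFlux halfExterior (fun x => F x ^ a • G x) ρ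
      + circleTerm (fun x => F x ^ a • G x) ρ) atTop (𝓝 B)) :
    ∃ n, ∀ s : ℝ, Tendsto (fun ρ => massFlux halfExterior (fun x => F x ^ s • G x) ρ
      + circleTerm (fun x => F x ^ s • G x) ρ) atTop (𝓝 (A - s * n)) := by
  rw [halfExterior_eq_outer] at *
  have hsub : ∀ s : ℝ, Tendsto (fun ρ =>
      massFlux (outer halfSpace) (fun x => F x ^ s • G x) ρ + circleTerm (fun x => F x ^ s • G x) ρ
        - (massFlux (outer halfSpace) G ρ + circleTerm G ρ
          - s * (2 * flux (outer halfSpace) (euclideanGradient (outer halfSpace) F) ρ)))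
      atTop (𝓝 0) := fun s => by
    have := (hF.tendsto_massFlux_rpow_smul_sub isRegularCone_halfSpace hG hq s).add
      (hF.tendsto_circleTerm_rpow_smul_sub hG hq s)
    rw [add_zero] at this
    exact this.congr fun ρ => by ring
  exact ⟨_, fun s => tendsto_sub_const_mul_of_tendsto_sub (hsub s) hA
    (tendsto_slope_of_tendsto_sub ha (hsub a) hA hB)⟩

end Masses

/-! ### Metrics in the coordinates of an end -/

theorem uniqueDiffOn_exterior : UniqueDiffOn ℝ exterior := by
  rw [exterior_eq_outer]
  exact isRegularCone_univ.uniqueDiffOn_outer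

theorem uniqueDiffOn_halfExterior : UniqueDiffOn ℝ halfExterior := by
  rw [halfExterior_eq_outer]
  exact isRegularCone_halfSpace.uniqueDiffOn_outer

variable {H : Type*} [TopologicalSpace H] {I : ModelWithCorners ℝ E3 H}
  {M : Type*} [TopologicalSpace M] [ChartedSpace H M]

namespace EndChart

variable {U : Set E3}

theorem mfderivWithin_invFun_ne_zero (e : EndChart I M U) (hU : UniqueDiffOn ℝ U) {x : E3}
    (hx : x ∈ U) {v : E3} (hv : v ≠ 0) : mfderivWithin 𝓘(ℝ, E3) I e.invFun U x v ≠ 0 := by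
  intro h0
  have hu : UniqueMDiffWithinAt 𝓘(ℝ, E3) U x := hU.uniqueMDiffOn x hx
  have hcomp := mfderivWithin_comp x
    ((e.contMDiffOn _ (e.mapsTo_inv hx)).mdifferentiableWithinAt (by simp))
    ((e.contMDiffOn_inv x hx).mdifferentiableWithinAt (by simp)) e.mapsTo_inv hu
  have hid : mfderivWithin 𝓘(ℝ, E3) 𝓘(ℝ, E3) (e.toFun ∘ e.invFun) U x
      = ContinuousLinearMap.id ℝ E3 :=
    (mfderivWithin_congr (fun y hy => e.right_inv hy) (e.right_inv hx)).trans (mfderivWithin_id hu)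
  have hv' := congrArg (fun L : E3 →L[ℝ] E3 => L v) (hid.symm.trans hcomp)
  refine hv (hv'.trans ?_)
  change mfderivWithin I 𝓘(ℝ, E3) e.toFun e.source (e.invFun x)
    (mfderivWithin 𝓘(ℝ, E3) I e.invFun U x v) = 0
  rw [h0, map_zero]

theorem contDiffOn_comp_invFun (e : EndChart I M U) {f : M → ℝ} (hf : ContMDiff I 𝓘(ℝ, ℝ) ∞ f) :
    ContDiffOn ℝ ∞ (f ∘ e.invFun) U :=
  contMDiffOn_iff_contDiffOn.1 (hf.comp_contMDiffOn e.contMDiffOn_inv)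

variable [IsManifold I ∞ M]

theorem contMDiffOn_mfderivWithin_invFun (e : EndChart I M U) (hU : UniqueDiffOn ℝ U) (v : E3) :
    ContMDiffOn 𝓘(ℝ, E3) I.tangent ∞ (fun x => (⟨e.invFun x,
      mfderivWithin 𝓘(ℝ, E3) I e.invFun U x v⟩ : TangentBundle I M)) U := by
  have hconst : ContMDiffOn 𝓘(ℝ, E3) 𝓘(ℝ, E3).tangent ∞
      (fun x => (⟨x, v⟩ : TangentBundle 𝓘(ℝ, E3) E3)) U :=
    contMDiffOn_vectorSpace_iff_contDiffOn.2 contDiffOn_const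
  exact (e.contMDiffOn_inv.contMDiffOn_tangentMapWithin (by simp) hU.uniqueMDiffOn).comp hconst
    fun x hx => hx

theorem contDiffOn_coordMetric (e : EndChart I M U) (hU : UniqueDiffOn ℝ U) (g : Metric3 I M)
    (i j : Fin 3) : ContDiffOn ℝ ∞ (fun x => coordMetric e g x i j) U := by
  rw [← contMDiffOn_iff_contDiffOn]
  have hg : ContMDiffOn 𝓘(ℝ, E3) (I.prod 𝓘(ℝ, E3 →L[ℝ] E3 →L[ℝ] ℝ)) ∞ (fun x =>
      TotalSpace.mk' (E3 →L[ℝ] E3 →L[ℝ] ℝ)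
        (E := fun p : M => TangentSpace I p →L[ℝ] TangentSpace I p →L[ℝ] ℝ)
        (e.invFun x) (g.inner (e.invFun x))) U :=
    g.contMDiff.comp_contMDiffOn e.contMDiffOn_inv
  have hpair : ContMDiffOn 𝓘(ℝ, E3) (I.prod 𝓘(ℝ, ℝ)) ∞ (fun x =>
      TotalSpace.mk' ℝ (E := Bundle.Trivial M ℝ) (e.invFun x) (coordMetric e g x i j)) U :=
    ContMDiffOn.clm_bundle_apply₂ (F₁ := E3) (F₂ := E3) hg
      (e.contMDiffOn_mfderivWithin_invFun hU _) (e.contMDiffOn_mfderivWithin_invFun hU _)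
  exact fun x hx => (contMDiffWithinAt_totalSpace.1 (hpair x hx)).2

theorem posDef_coordMetric (e : EndChart I M U) (hU : UniqueDiffOn ℝ U) (g : Metric3 I M) {x : E3}
    (hx : x ∈ U) : (coordMetric e g x).PosDef := by
  let D : E3 →ₗ[ℝ] TangentSpace I (e.invFun x) :=
    (mfderivWithin 𝓘(ℝ, E3) I e.invFun U x).toLinearMap
  let B : LinearMap.BilinForm ℝ E3 := LinearMap.mk₂ ℝ (fun v w => g.inner (e.invFun x) (D v) (D w))
    (by simp) (by simp) (by simp) (by simp)
  have hsymm : B.IsSymm := ⟨fun v w => g.symm _ _ _⟩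
  have hpos : B.toQuadraticMap.PosDef := fun v hv =>
    g.pos _ _ (e.mfderivWithin_invFun_ne_zero hU hx hv)
  have hB : coordMetric e g x
      = LinearMap.BilinForm.toMatrix (EuclideanSpace.basisFun (Fin 3) ℝ).toBasis B := by
    ext i j
    rw [LinearMap.BilinForm.toMatrix_apply, OrthonormalBasis.coe_toBasis,
      EuclideanSpace.basisFun_apply, EuclideanSpace.basisFun_apply]
    rfl
  rw [hB]
  exact (LinearMap.BilinForm.posDef_toQuadraticMap_iff_matrix _ B hsymm).1 hpos

theorem isSmoothMetric (e : EndChart I M U) (hU : UniqueDiffOn ℝ U) (g : Metric3 I M) :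
    IsSmoothMetric U (coordMetric e g) where
  uniqueDiffOn := hU
  contDiffOn := e.contDiffOn_coordMetric hU g
  posDef _ hx := e.posDef_coordMetric hU g hx

end EndChart

variable [IsManifold I ∞ M] {g : Metric3 I M} {f : M → ℝ}

theorem IsConformalFactor.exists_decayingFactor {e : EndChart I M exterior} {q : ℝ}
    (h : IsConformalFactor e g f) (hf : ContMDiff I 𝓘(ℝ, ℝ) ∞ f) (hpos : ∀ p, 0 < f p)
    (hq : DecaysAtRate exterior q (coordMetric e g)) :
    ∃ q', 1 / 2 < q' ∧ DecayingFactor exterior q' (f ∘ e.invFun) := by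
  obtain ⟨⟨q', hq', -, hO⟩, -⟩ := h
  have hgrad : ∀ x, 0 ≤ ‖x‖ * gradientNorm exterior (coordMetric e g) (f ∘ e.invFun) x := fun x =>
    mul_nonneg (norm_nonneg _) (Real.sqrt_nonneg _)
  have hsub : DecayO exterior (-q') fun x => f (e.invFun x) - 1 :=
    (IsBigO.of_norm_le fun x => (le_add_of_nonneg_right (hgrad x))).trans hO
  have hpd := hq.decayO_pd_of_gradientNorm (F := f ∘ e.invFun) (p := -q') <|
    (IsBigO.of_norm_le fun x => by
      rw [Real.norm_of_nonneg (hgrad x)]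
      exact le_add_of_nonneg_left (abs_nonneg _)).trans hO
  exact ⟨q', hq', e.contDiffOn_comp_invFun hf, fun x _ => hpos _, hsub, hpd⟩

theorem exists_hasADMMass_conformal {e : EndChart I M exterior} (hAF : IsAsymptoticallyFlat e g)
    (hf : ContMDiff I 𝓘(ℝ, ℝ) ∞ f) (hpos : ∀ p, 0 < f p) (hcf : IsConformalFactor e g f) :
    ∃ m n : ℝ, HasADMMass e g m ∧
      ∀ s, HasADMMass e (conformal g f hf hpos s) (m - s * n) := by
  have hG := e.isSmoothMetric uniqueDiffOn_exterior g
  obtain ⟨q, hq⟩ := hAF.1.exists_decaysAtRate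
  obtain ⟨q', hq', hF⟩ := hcf.exists_decayingFactor hf hpos hq
  obtain ⟨A, n, hA, hs⟩ := (hF.mono (min_le_right q q')).exists_tendsto_massFlux_rpow_smul hG
    (hq.mono (lt_min hq.half_lt hq') (min_le_left q q')) hAF.2 hcf.2
  refine ⟨1 / (16 * Real.pi) * A, 1 / (16 * Real.pi) * n, hA.const_mul _, fun s => ?_⟩
  rw [mul_left_comm, ← mul_sub]
  exact (hs s).const_mul _

theorem exists_hasHalfSpaceMass_conformal {e : EndChart I M halfExterior} {a : ℝ} (ha : a ≠ 0)
    (hf : ContMDiff I 𝓘(ℝ, ℝ) ∞ f) (hpos : ∀ p, 0 < f p)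
    (hAF : IsAsymptoticallyFlatHalfSpace e g)
    (hAF' : IsAsymptoticallyFlatHalfSpace e (conformal g f hf hpos a)) :
    ∃ m n : ℝ, HasHalfSpaceMass e g m ∧
      ∀ s, HasHalfSpaceMass e (conformal g f hf hpos s) (m - s * n) := by
  have hG := e.isSmoothMetric uniqueDiffOn_halfExterior g
  have hG' := e.isSmoothMetric uniqueDiffOn_halfExterior (conformal g f hf hpos a)
  obtain ⟨q₁, hq₁⟩ := hAF.1.exists_decaysAtRate
  obtain ⟨q₂, hq₂⟩ := hAF'.1.exists_decaysAtRate
  have hmin : 1 / 2 < min q₁ q₂ := lt_min hq₁.half_lt hq₂.half_lt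
  obtain ⟨A, hA⟩ := exists_tendsto_massFlux_add_circleTerm hG hq₁ hAF.2.1 hAF.2.2
  obtain ⟨B, hB⟩ := exists_tendsto_massFlux_add_circleTerm hG' hq₂ hAF'.2.1 hAF'.2.2
  have hq := hq₁.mono hmin (min_le_left _ _)
  have hF := hq.decayingFactor_of_rpow_smul ha hG (hq₂.mono hmin (min_le_right _ _))
    (e.contDiffOn_comp_invFun hf) fun x _ => hpos _
  obtain ⟨n, hs⟩ := hF.exists_tendsto_massFlux_add_circleTerm_rpow_smul ha hG hq hA hB
  refine ⟨1 / (16 * Real.pi) * A, 1 / (16 * Real.pi) * n, hA.const_mul _, fun s => ?_⟩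
  rw [mul_left_comm, ← mul_sub]
  exact (hs s).const_mul _

end ConformalMass

theorem lemma3_general {H : Type*} [TopologicalSpace H]
    {I : ModelWithCorners ℝ ConformalMass.E3 H}
    {M : Type*} [TopologicalSpace M] [ChartedSpace H M] [IsManifold I ∞ M]
    (g : ConformalMass.Metric3 I M) (f : M → ℝ) (hf : ContMDiff I 𝓘(ℝ, ℝ) ∞ f)
    (hpos : ∀ p, 0 < f p) (lam : ℝ) :
    (∀ e : ConformalMass.EndChart I M ConformalMass.exterior,
      ConformalMass.IsAsymptoticallyFlat e g →
      ConformalMass.IsConformalFactor e g f →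
      ∃ m m' : ℝ,
        ConformalMass.HasADMMass e g m ∧
        ConformalMass.HasADMMass e (ConformalMass.conformal g f hf hpos 4) m' ∧
        ConformalMass.HasADMMass e (ConformalMass.conformal g f hf hpos (4 * lam))
          ((1 - lam) * m + lam * m')) ∧
    (∀ e : ConformalMass.EndChart I M ConformalMass.halfExterior,
      ConformalMass.IsAsymptoticallyFlatHalfSpace e g →
      ConformalMass.IsAsymptoticallyFlatHalfSpace e (ConformalMass.conformal g f hf hpos 4) →
      ∃ m m' : ℝ,
        ConformalMass.HasHalfSpaceMass e g m ∧
        ConformalMass.HasHalfSpaceMass e (ConformalMass.conformal g f hf hpos 4) m' ∧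
        ConformalMass.HasHalfSpaceMass e (ConformalMass.conformal g f hf hpos (4 * lam))
          ((1 - lam) * m + lam * m')) := by
  have haffine : ∀ m n : ℝ, (1 - lam) * m + lam * (m - 4 * n) = m - 4 * lam * n :=
    fun m n => by ring
  refine ⟨fun e hAF hcf => ?_, fun e hAF hAF' => ?_⟩
  · obtain ⟨m, n, hm, hs⟩ := ConformalMass.exists_hasADMMass_conformal hAF hf hpos hcf
    exact ⟨m, m - 4 * n, hm, hs 4, haffine m n ▸ hs (4 * lam)⟩
  · obtain ⟨m, n, hm, hs⟩ :=
      ConformalMass.exists_hasHalfSpaceMass_conformal four_ne_zero hf hpos hAF hAF'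
    exact ⟨m, m - 4 * n, hm, hs 4, haffine m n ▸ hs (4 * lam)⟩

theorem lemma3 {H : Type*} [TopologicalSpace H] {I : ModelWithCorners ℝ ConformalMass.E3 H}
    {M : Type*} [TopologicalSpace M] [ChartedSpace H M] [IsManifold I ∞ M]
    (g : ConformalMass.Metric3 I M) (f : M → ℝ) (hf : ContMDiff I 𝓘(ℝ, ℝ) ∞ f)
    (hpos : ∀ p, 0 < f p) (lam : ℝ) (hlam : lam ∈ Set.Icc (0 : ℝ) 1) :
    (∀ e : ConformalMass.EndChart I M ConformalMass.exterior,
      ConformalMass.IsAsymptoticallyFlat e g →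
      ConformalMass.IsConformalFactor e g f →
      ∃ m m' : ℝ,
        ConformalMass.HasADMMass e g m ∧
        ConformalMass.HasADMMass e (ConformalMass.conformal g f hf hpos 4) m' ∧
        ConformalMass.HasADMMass e (ConformalMass.conformal g f hf hpos (4 * lam))
          ((1 - lam) * m + lam * m')) ∧
    (∀ e : ConformalMass.EndChart I M ConformalMass.halfExterior,
      ConformalMass.IsAsymptoticallyFlatHalfSpace e g →
      ConformalMass.IsAsymptoticallyFlatHalfSpace e (ConformalMass.conformal g f hf hpos 4) →
      ∃ m m' : ℝ,
        ConformalMass.HasHalfSpaceMass e g m ∧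
        ConformalMass.HasHalfSpaceMass e (ConformalMass.conformal g f hf hpos 4) m' ∧
        ConformalMass.HasHalfSpaceMass e (ConformalMass.conformal g f hf hpos (4 * lam))
          ((1 - lam) * m + lam * m')) :=
  lemma3_general g f hf hpos lam
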